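/- Conventions. A compact $n$-polyhedral length space is a finite simplicial complex $X$ of dimension $n$ endowed with an intrinsic metric inducing its topology (the distance between two points is the infimum of the lengths of the paths joining them). For a function $\rho : X \to (0,\infty]$, the space $X$ *$\rho$-collapses* if there is a continuous map $\pi : X \to P$ to a finite simplicial complex $P$ of dimension at most $n-1$ such that every fiber of $\pi$ lies in an open ball $B(x,\rho(x))$ for some $x \in X$. Let $X$ be connected and let $\phi : \pi_1(X) \to G$ be a homomorphism to a discrete group $G$. The space $X$ is *$\phi$-essential* if the classifying map $\Phi : X \to K(G,1)$ induced by $\phi$ (the map, unique up to homotopy, that induces $\phi$ on fundamental groups) is not homotopic to a composite $X \to P \to K(G,1)$ of continuous maps through a simplicial complex $P$ of dimension at most $n-1$. The *$\phi$-systolic function* of $X$ is $$\mathrm{sys}_\phi(x) = \inf\{ \mathrm{length}(\gamma) \mid \gamma \text{ is a loop of } X \text{ based at } x \text{ with } \phi([\gamma]) \neq 1 \},$$ where the condition $\phi([\gamma]) \ne 1$ does not depend on the path used to move $\gamma$ to the basepoint of $\pi_1(X)$. Proposition. Let $X$ be a connected compact $n$-polyhedral length space and let $\phi : \pi_1(X)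 \to G$ be a nontrivial homomorphism to a discrete group $G$. If $X$ is $\phi$-essential, then $X$ does not $\frac12 \mathrm{sys}_\phi$-collapse. -/

import Mathlib

open scoped ENNReal

universe u v w

/-- The geometric realization of a simplicial complex on a finite set of vertices: the union, over
the faces `s`, of the closed simplices spanned by `s`, in barycentric coordinates, with the subspace
topology. -/
def realization {ι : Type*} [Fintype ι] (K : PreAbstractSimplicialComplex ι) : Set (ι → ℝ) :=
  {w | w ∈ stdSimplex ℝ ι ∧ ∃ s ∈ K.faces, ∀ i ∉ s, w i = 0}

/-- The length of a path in a metric space, that is, the supremum of the lengths of the inscribed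
polygonal chains. -/
noncomputable def pathLength {X : Type*} [PseudoEMetricSpace X] {x y : X} (γ : Path x y) : ℝ≥0∞ :=
  eVariationOn γ Set.univ

/-- The metric is intrinsic: distances are infima of lengths of paths. -/
def IsLengthSpace (X : Type*) [PseudoEMetricSpace X] : Prop :=
  ∀ x y : X, edist x y = ⨅ γ : Path x y, pathLength γ

/-- A compact `n`-polyhedral length space: (a space identified with) a finite simplicial complex of
dimension `n`, endowed with an intrinsic metric that induces its topology. -/
structure IsPolyhedralLengthSpace (n : ℕ) (X : Type*) [PseudoEMetricSpace X] : Prop where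
  exists_triangulation : ∃ (m : ℕ) (K : PreAbstractSimplicialComplex (Fin m)),
    (∀ s ∈ K.faces, s.card ≤ n + 1) ∧ (∃ s ∈ K.faces, s.card = n + 1) ∧
      Nonempty (X ≃ₜ realization K)
  isLengthSpace : IsLengthSpace X

/-- `X` `ρ`-collapses (in dimension `n`): there is a continuous map from `X` to a finite simplicial
complex of dimension at most `n - 1` (at most `n` vertices in each face) each of whose fibers lies
in an open ball `B(x, ρ x)`. -/
def Collapses (n : ℕ) {X : Type*} [PseudoEMetricSpace X] (ρ : X → ℝ≥0∞) : Prop :=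
  ∃ (m : ℕ) (P : PreAbstractSimplicialComplex (Fin m)), (∀ s ∈ P.faces, s.card ≤ n) ∧
    ∃ π : C(X, realization P), ∀ p : realization P, ∃ x : X, π ⁻¹' {p} ⊆ Metric.eball x (ρ x)

/-- `K` is a `K(G, 1)`: a path-connected space with fundamental group isomorphic to `G` and all
higher homotopy groups trivial. -/
structure IsEilenbergMacLaneOne (G : Type*) [Group G] (K : Type*) [TopologicalSpace K] :
    Prop where
  pathConnected : PathConnectedSpace K
  pi_one : ∀ k : K, Nonempty (FundamentalGroup K k ≃* G)
  pi_higher : ∀ (i : ℕ) (k : K), 2 ≤ i → Subsingleton (HomotopyGroup (Fin i) K k)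

/-- `Φ : X → K` is, for `K` a `K(G, 1)`, a classifying map induced by `φ : π₁(X, x₀) → G`: under
some identification of `π₁(K, Φ x₀)` with `G`, the homomorphism induced by `Φ` is `φ`. -/
def IsClassifyingMap {X : Type*} [TopologicalSpace X] {x₀ : X} {G : Type*} [Group G]
    (φ : FundamentalGroup X x₀ →* G) {K : Type*} [TopologicalSpace K] (Φ : C(X, K)) : Prop :=
  IsEilenbergMacLaneOne G K ∧
    ∃ θ : FundamentalGroup K (Φ x₀) ≃* G, ∀ g, θ (FundamentalGroup.map Φ x₀ g) = φ g

/-- `Φ : X → K` is homotopic to a map that factors through a simplicial complex `P` of dimension at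
most `n - 1`. As `X` is compact in all uses, only a finite subcomplex of `P` matters, so that `P` is
taken finite. -/
def FactorsThroughLowerComplex (n : ℕ) {X : Type*} [TopologicalSpace X]
    {K : Type*} [TopologicalSpace K] (Φ : C(X, K)) : Prop :=
  ∃ (m : ℕ) (P : PreAbstractSimplicialComplex (Fin m)), (∀ s ∈ P.faces, s.card ≤ n) ∧
    ∃ (f : C(X, realization P)) (g : C(realization P, K)), Φ.Homotopic (g.comp f)

/-- `X`, of dimension `n`, is `φ`-essential: the classifying map `X → K(G, 1)` induced by `φ` is not
homotopic to a map that factors through a simplicial `(n-1)`-complex. Since a `K(G, 1)` and the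
classifying map of a finite complex are unique up to (weak) homotopy equivalence and homotopy, it
does not matter which ones are used. -/
def IsEssential.{x, y, z} (n : ℕ) {X : Type x} [TopologicalSpace X] {x₀ : X} {G : Type y} [Group G]
    (φ : FundamentalGroup X x₀ →* G) : Prop :=
  ∃ (K : Type z) (_ : TopologicalSpace K) (Φ : C(X, K)),
    IsClassifyingMap φ Φ ∧ ¬ FactorsThroughLowerComplex n Φ

/-- The loop `γ` based at `x` is not in the kernel of `φ : π₁(X, x₀) → G`, once it is moved to the
basepoint `x₀` along a path `c`; this does not depend on the choice of `c`. -/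
def IsNontrivialLoop {X : Type*} [TopologicalSpace X] {x₀ : X} {G : Type*} [Group G]
    (φ : FundamentalGroup X x₀ →* G) {x : X} (γ : Path x x) : Prop :=
  ∃ c : Path x₀ x, φ (FundamentalGroup.fromPath
    (Path.Homotopic.Quotient.mk ((c.trans γ).trans c.symm))) ≠ 1

/-- The `φ`-systolic function of `X`: the infimum of the lengths of the loops based at `x` whose
class is not in the kernel of `φ`. -/
noncomputable def systolicFunction {X : Type*} [PseudoEMetricSpace X] {x₀ : X} {G : Type*} [Group G]
    (φ : FundamentalGroup X x₀ →* G) (x : X) : ℝ≥0∞ :=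
  ⨅ (γ : Path x x) (_ : IsNontrivialLoop φ γ), pathLength γ

/-! Suppose that `π : X → P` is a collapse. Its fibers lie in balls `B(x, r)` with `2r` equal to the
systole at `x`, and every loop in such a ball dies under `Φ`. Indeed, cut the loop into small arcs
and join the cut points to `x` by paths of length less than `r`. Up to `Φ`-class each arc may be
replaced by a short one, so that it closes up to a loop at `x` of length less than `2r`, which `φ`
kills (`loopsNullOn_eball`).

It remains to factor `Φ` through dimension at most `n - 1` (`factorsThroughLowerComplex_of_fibers`).
Fibers need not be connected, so `Φ` need not factor through `P` itself; a discrete Stein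
factorization takes its place. A fine cover of `P` of multiplicity at most `n` is pulled back to
`X`, and a finer cover of `X` has each member assigned to a pulled-back set. Chains of overlapping
members with the same assignment play the role of the components of the pulled-back sets.
Identifying the vertices of each chain sends the nerve `L` of the finer cover to a complex `N` with
at most `n` vertices in each face. The covers come from the Freudenthal triangulation
(`exists_fine_cover`).

Both `L` and `N` lie in a complex `M` that also contains the segments from points of `L` to their
images in `N`. The map given by `Φ` on `L` extends over `M` (`exists_extension_faceUnion`): edges
follow paths in `X`, triangles fill because nearby loops die under `Φ`, and higher simplices fill
because the higher homotopy groups of `K` vanish. Sliding along the segments makes `Φ` homotopic to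
a map through `N`. -/

open CategoryTheory Set Filter Topology unitInterval

/-! ### Lengths of paths -/

section PathLength

variable {X : Type*} [PseudoEMetricSpace X]

lemma edist_le_pathLength {x y : X} (γ : Path x y) (t : I) : edist x (γ t) ≤ pathLength γ := by
  have := eVariationOn.edist_le (γ : I → X) (mem_univ (0 : I)) (mem_univ t)
  simpa [pathLength] using this

lemma pathLength_symm_le {x y : X} (γ : Path x y) : pathLength γ.symm ≤ pathLength γ := by
  have : (γ.symm : I → X) = γ ∘ σ := by ext; simp
  rw [pathLength, this]
  exact eVariationOn.comp_le_of_antitoneOn _ _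
    (fun a _ b _ h => by simpa using h) (fun _ _ => mem_univ _)

lemma pathLength_trans_le {x y z : X} (γ : Path x y) (γ' : Path y z) :
    pathLength (γ.trans γ') ≤ pathLength γ + pathLength γ' := by
  let h : I := ⟨1 / 2, by norm_num, by norm_num⟩
  have hU : eVariationOn (γ.trans γ') (Iic h ∪ Ici h)
      = eVariationOn (γ.trans γ') (Iic h) + eVariationOn (γ.trans γ') (Ici h) :=
    eVariationOn.union _ isGreatest_Iic isLeast_Ici
  rw [Iic_union_Ici] at hU
  rw [pathLength, hU]
  refine add_le_add ?_ ?_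
  · have e : EqOn (γ.trans γ') (γ ∘ fun t : I => projIcc 0 1 zero_le_one (2 * (t : ℝ))) (Iic h) := by
      intro t ht
      have ht' : (t : ℝ) ≤ 1 / 2 := ht
      simp only [Path.trans_apply, ht', dite_true, Function.comp]
      rw [projIcc_of_mem]
    rw [eVariationOn.congr e]
    refine eVariationOn.comp_le_of_monotoneOn _ _ (fun a _ b _ hab => ?_) (fun _ _ => mem_univ _)
    exact monotone_projIcc _ (by have : (a : ℝ) ≤ b := hab
                                 linarith)
  · have e : EqOn (γ.trans γ') (γ' ∘ fun t : I => projIcc 0 1 zero_le_one (2 * (t : ℝ) - 1))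
        (Ici h) := by
      intro t ht
      have ht' : 1 / 2 ≤ (t : ℝ) := ht
      rcases ht'.eq_or_lt with h1 | h1
      · simp [Path.trans_apply, ← h1]
      · simp only [Path.trans_apply, not_le.2 h1, dite_false, Function.comp]
        rw [projIcc_of_mem]
    rw [eVariationOn.congr e]
    refine eVariationOn.comp_le_of_monotoneOn _ _ (fun a _ b _ hab => ?_) (fun _ _ => mem_univ _)
    exact monotone_projIcc _ (by have : (a : ℝ) ≤ b := hab
                                 linarith)

lemma IsLengthSpace.exists_path_lt (hX : IsLengthSpace X) {x y : X} {r : ℝ≥0∞}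
    (h : edist x y < r) : ∃ γ : Path x y, pathLength γ < r := by
  rw [hX x y] at h
  exact iInf_lt_iff.1 h

end PathLength

/-! ### Classes of paths after applying `Φ` -/

section PathClass

variable {X : Type*} [TopologicalSpace X] {K : Type*} [TopologicalSpace K] (Φ : C(X, K))

/-- The homotopy class, in the fundamental groupoid of `K`, of the image of a path under `Φ`. -/
def pathClass {x y : X} (γ : Path x y) :
    FundamentalGroupoid.mk (Φ x) ⟶ FundamentalGroupoid.mk (Φ y) :=
  Path.Homotopic.Quotient.mk (γ.map Φ.continuous)

variable {Φ}

lemma pathClass_eq_iff {x y : X} {γ γ' : Path x y} :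
    pathClass Φ γ = pathClass Φ γ' ↔ (γ.map Φ.continuous).Homotopic (γ'.map Φ.continuous) :=
  Path.Homotopic.Quotient.eq

lemma pathClass_congr {x y : X} {γ γ' : Path x y} (h : γ.Homotopic γ') :
    pathClass Φ γ = pathClass Φ γ' :=
  pathClass_eq_iff.2 (h.map Φ)

@[simp] lemma pathClass_refl (x : X) : pathClass Φ (Path.refl x) = 𝟙 _ := rfl

@[simp] lemma pathClass_trans {x y z : X} (γ : Path x y) (γ' : Path y z) :
    pathClass Φ (γ.trans γ') = pathClass Φ γ ≫ pathClass Φ γ' := by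
  simp only [pathClass, Path.map_trans, Path.Homotopic.Quotient.mk_trans]
  rfl

@[simp] lemma pathClass_symm {x y : X} (γ : Path x y) :
    pathClass Φ γ.symm = inv (pathClass Φ γ) := by
  rw [← cancel_epi (pathClass Φ γ), IsIso.hom_inv_id, ← pathClass_trans, ← pathClass_refl]
  exact pathClass_congr (Path.Homotopic.trans_symm γ)

variable (Φ) in
/-- Every loop with image in `B` has a null-homotopic image under `Φ`. -/
def LoopsNullOn (B : Set X) : Prop :=
  ∀ (x : X) (γ : Path x x), (∀ t, γ t ∈ B) → pathClass Φ γ = 𝟙 _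

lemma LoopsNullOn.mono {B B' : Set X} (h : LoopsNullOn Φ B) (hB : B' ⊆ B) : LoopsNullOn Φ B' :=
  fun x γ hγ => h x γ fun t => hB (hγ t)

lemma Path.trans_mem {B : Set X} {x y z : X} {γ : Path x y} {γ' : Path y z} (h : ∀ t, γ t ∈ B)
    (h' : ∀ t, γ' t ∈ B) (t : I) : (γ.trans γ') t ∈ B := by
  rw [Path.trans_apply]
  split_ifs
  exacts [h _, h' _]

lemma LoopsNullOn.pathClass_eq {B : Set X} (h : LoopsNullOn Φ B) {x y : X} {γ γ' : Path x y}
    (hγ : ∀ t, γ t ∈ B) (hγ' : ∀ t, γ' t ∈ B) : pathClass Φ γ = pathClass Φ γ' := by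
  have := h x (γ.trans γ'.symm) (Path.trans_mem hγ fun t => hγ' _)
  rwa [pathClass_trans, pathClass_symm, IsIso.comp_inv_eq, Category.id_comp] at this

lemma pathClass_subpath_trans {x y : X} (γ : Path x y) (s t r : I) :
    pathClass Φ (γ.subpath s t) ≫ pathClass Φ (γ.subpath t r) = pathClass Φ (γ.subpath s r) := by
  rw [← pathClass_trans]
  exact pathClass_congr ⟨Path.Homotopy.subpathTransSubpath γ s t r⟩

end PathClass

/-! ### Loops in balls of half the systolic radius -/

/-- A ball of radius `r` in a length space contains only loops with null-homotopic image, if the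
loops of length less than `2 r` at its centre have null-homotopic image. -/
theorem loopsNullOn_eball {X : Type*} [PseudoEMetricSpace X] (hX : IsLengthSpace X)
    {K : Type*} [TopologicalSpace K] {Φ : C(X, K)}
    (hloc : ∀ x : X, ∃ U ∈ 𝓝 x, LoopsNullOn Φ U) {x : X} {r : ℝ≥0∞}
    (hshort : ∀ γ : Path x x, pathLength γ < r + r → pathClass Φ γ = 𝟙 _) :
    LoopsNullOn Φ (Metric.eball x r) := by
  intro y γ hγ
  have huniq : ∀ {z : X} (β β' : Path x z), pathLength β < r → pathLength β' < r →
      pathClass Φ β = pathClass Φ β' := by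
    intro z β β' hβ hβ'
    have := hshort (β.trans β'.symm) ((pathLength_trans_le _ _).trans_lt
      (ENNReal.add_lt_add hβ ((pathLength_symm_le _).trans_lt hβ')))
    rwa [pathClass_trans, pathClass_symm, IsIso.comp_inv_eq, Category.id_comp] at this
  -- By `huniq`, paths of length less than `r` from `x` to a given point all have one class. Near
  -- `y₀`, following an arc `α` carries the class at its start to the class at its end.
  have hlocal : ∀ y₀ ∈ Metric.eball x r, ∃ W ∈ 𝓝 y₀, ∀ (y₁ y₂ : X) (α : Path y₁ y₂),
      (∀ t, α t ∈ W) → ∀ (β₁ : Path x y₁) (β₂ : Path x y₂), pathLength β₁ < r →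
      pathLength β₂ < r → pathClass Φ β₁ ≫ pathClass Φ α = pathClass Φ β₂ := by
    intro y₀ hy₀
    obtain ⟨U, hU, hnull⟩ := hloc y₀
    obtain ⟨ε, hε, hεU⟩ := EMetric.mem_nhds_iff.1 hU
    have hy₀' : edist x y₀ < r := by rw [edist_comm]; exact hy₀
    -- A path of length less than `2δ` starting within `δ` of `y₀` stays within `ε`; the second
    -- bound lets such a path follow one of length less than `d(x, y₀) + δ` and keep total length
    -- below `r`.
    obtain ⟨δ, hδ, hδε, hδr⟩ : ∃ δ : ℝ≥0∞, 0 < δ ∧ δ + (δ + δ) ≤ ε ∧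
        edist x y₀ + δ + (δ + δ) ≤ r := by
      have h0 : 0 < min ε (r - edist x y₀) := lt_min hε (tsub_pos_iff_lt.2 hy₀')
      refine ⟨min ε (r - edist x y₀) / 3, ENNReal.div_pos h0.ne' (by norm_num), ?_, ?_⟩
      · rw [← add_assoc, ENNReal.add_thirds]
        exact min_le_left _ _
      · rw [add_assoc, ← add_assoc (min ε (r - edist x y₀) / 3), ENNReal.add_thirds]
        calc edist x y₀ + min ε (r - edist x y₀) ≤ edist x y₀ + (r - edist x y₀) := by
              gcongr; exact min_le_right _ _
          _ = r := add_tsub_cancel_of_le hy₀'.le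
    refine ⟨Metric.eball y₀ δ, Metric.eball_mem_nhds _ hδ, ?_⟩
    intro y₁ y₂ α hα β₁ β₂ hβ₁ hβ₂
    have h1 : edist y₁ y₀ < δ := by simpa using hα 0
    have h2 : edist y₂ y₀ < δ := by simpa using hα 1
    have h12 : edist y₁ y₂ < δ + δ := (edist_triangle_right y₁ y₂ y₀).trans_lt
      (ENNReal.add_lt_add h1 h2)
    obtain ⟨α', hα'⟩ := hX.exists_path_lt h12
    have hx1 : edist x y₁ < edist x y₀ + δ := by
      have hfin : edist x y₀ ≠ ⊤ := (hy₀'.trans_le le_top).ne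
      calc edist x y₁ ≤ edist x y₀ + edist y₀ y₁ := edist_triangle _ _ _
        _ < _ := by
          rw [edist_comm y₀]
          exact ENNReal.add_lt_add_left hfin h1
    obtain ⟨β, hβ⟩ := hX.exists_path_lt hx1
    have hβr : pathLength β < r := hβ.trans_le (le_trans (le_add_of_nonneg_right (zero_le)) hδr)
    rw [huniq β₁ β hβ₁ hβr]
    have hαα' : pathClass Φ α = pathClass Φ α' := by
      refine hnull.pathClass_eq (fun t => hεU ?_) (fun t => hεU ?_)
      · have : edist (α t) y₀ < δ := hα t
        exact this.trans_le ((le_add_of_nonneg_right (zero_le)).trans hδε)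
      · have := (edist_le_pathLength α' t).trans_lt hα'
        rw [edist_comm] at this
        exact ((edist_triangle _ y₁ _).trans_lt
          ((ENNReal.add_lt_add this h1).trans_eq (add_comm _ _))).trans_le hδε
    rw [hαα', ← pathClass_trans]
    refine huniq _ _ ?_ hβ₂
    exact (pathLength_trans_le _ _).trans_lt ((ENNReal.add_lt_add hβ hα').trans_le hδr)
  -- The local statement spreads over the connected interval. Transitivity needs a path of length
  -- less than `r` to the intermediate point, which exists because `γ` stays in the ball.
  have hP : ∀ (β₁ : Path x (γ 0)) (β₂ : Path x (γ 1)), pathLength β₁ < r → pathLength β₂ < r →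
      pathClass Φ β₁ ≫ pathClass Φ (γ.subpath 0 1) = pathClass Φ β₂ := by
    refine isPreconnected_univ.induction₂ (s := (univ : Set I))
      (fun s t => ∀ (β₁ : Path x (γ s)) (β₂ : Path x (γ t)), pathLength β₁ < r →
        pathLength β₂ < r → pathClass Φ β₁ ≫ pathClass Φ (γ.subpath s t) = pathClass Φ β₂)
      ?_ ?_ ?_ (mem_univ 0) (mem_univ 1)
    · intro s _
      obtain ⟨W, hW, h⟩ := hlocal (γ s) (hγ s)
      rw [nhdsWithin_univ]
      have hW' : γ ⁻¹' W ∈ 𝓝 s := γ.continuous.continuousAt hW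
      obtain ⟨ε, hε, hεW⟩ := Metric.mem_nhds_iff.1 hW'
      filter_upwards [Metric.ball_mem_nhds s hε] with t ht
      refine h _ _ _ (fun τ => ?_)
      have hτ : γ.subpath s t τ ∈ range (γ.subpath s t) := mem_range_self τ
      rw [Path.range_subpath] at hτ
      obtain ⟨ξ, hξ, hξ'⟩ := hτ
      rw [← hξ']
      refine hεW ?_
      rw [Metric.mem_ball, dist_comm] at ht ⊢
      have hξ' : (ξ : ℝ) ∈ uIcc (s : ℝ) t := ⟨hξ.1, hξ.2⟩
      exact (Real.dist_left_le_of_mem_uIcc hξ').trans_lt ht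
    · intro s t t' _ _ _ h h' β₁ β₃ hβ₁ hβ₃
      obtain ⟨β₂, hβ₂⟩ := hX.exists_path_lt (x := x) (y := γ t) (r := r)
        (by rw [edist_comm]; exact hγ t)
      rw [← pathClass_subpath_trans γ s t t', ← Category.assoc, h β₁ β₂ hβ₁ hβ₂,
        h' β₂ β₃ hβ₂ hβ₃]
    · intro s t _ _ h β₁ β₂ hβ₁ hβ₂
      rw [← h β₂ β₁ hβ₂ hβ₁, Category.assoc, pathClass_subpath_trans, Path.subpath_self,
        pathClass_refl, Category.comp_id]
  -- With the same `β` at both ends of the loop, `β` followed by `γ` has the class of `β`, and `β`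
  -- cancels.
  obtain ⟨β, hβ⟩ := hX.exists_path_lt (x := x) (y := y) (r := r)
    (by rw [edist_comm]; simpa using hγ 0)
  have h := hP (β.cast rfl γ.source) (β.cast rfl γ.target) hβ hβ
  have key : ∀ (a b : X) (δ : Path y y) (ha : a = y) (hb : b = y)
      (h : pathClass Φ (β.cast rfl ha) ≫ pathClass Φ (δ.cast ha hb) =
        pathClass Φ (β.cast rfl hb)), pathClass Φ δ = 𝟙 _ := by
    intro a b δ ha hb h
    subst ha; subst hb
    rw [Path.cast_rfl_rfl, Path.cast_rfl_rfl] at h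
    rwa [← cancel_epi (pathClass Φ β), Category.comp_id]
  exact key _ _ γ γ.source γ.target (by rw [← Path.subpath_zero_one]; exact h)

/-! ### The Freudenthal triangulation in partial-sum coordinates -/

section Lattice

/-- The lattice points `z` obtained by rounding `y` up or down, such that the errors of two
coordinates differ by less than one: the vertices of the simplex of the Freudenthal triangulation
whose interior contains `y`. -/
def IsFreudenthalVertex {ι : Type*} (y : ι → ℝ) (z : ι → ℤ) : Prop :=
  ∀ i j, (y i - z i) - (y j - z j) < 1

lemma IsFreudenthalVertex.eq_or {ι : Type*} {y : ι → ℝ} {z : ι → ℤ} (h : IsFreudenthalVertex y z)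
    {i₀ : ι} (hy : y i₀ = 0) (hz : z i₀ = 0) (i : ι) : z i = ⌊y i⌋ ∨ z i = ⌊y i⌋ + 1 := by
  have h1 := h i i₀
  have h2 := h i₀ i
  rw [hy, hz] at h1 h2
  have h3 := Int.floor_le (y i)
  have h4 := Int.lt_floor_add_one (y i)
  have h5 : ((⌊y i⌋ - 1 : ℤ) : ℝ) < z i := by push_cast at *; linarith
  have h6 : (z i : ℝ) < ((⌊y i⌋ + 2 : ℤ) : ℝ) := by push_cast at *; linarith
  have h5' := Int.cast_lt.1 h5
  have h6' := Int.cast_lt.1 h6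
  omega

/-- A vertex `z` is determined by a threshold: it rounds `y` down exactly at the coordinates whose
fractional part is at most the largest one rounded down, since otherwise two errors would differ by
at least one. The coordinate `i₀` is always rounded down, so the threshold exists. -/
lemma card_isFreudenthalVertex_le {ι : Type*} [Fintype ι] {y : ι → ℝ} {i₀ : ι} (hy : y i₀ = 0)
    (Z : Finset (ι → ℤ)) (hZ : ∀ z ∈ Z, IsFreudenthalVertex y z ∧ z i₀ = 0) (V : Finset ℝ)
    (hV : ∀ i, Int.fract (y i) ∈ V) : Z.card ≤ V.card := by
  classical
  have hmax : ∀ z ∈ Z, ∃ i, z i = ⌊y i⌋ ∧ ∀ j, z j = ⌊y j⌋ → Int.fract (y j) ≤ Int.fract (y i) := by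
    intro z hz
    obtain ⟨i, hi, hi'⟩ := Finset.exists_max_image (Finset.univ.filter fun i => z i = ⌊y i⌋)
      (fun i => Int.fract (y i)) ⟨i₀, by simp [hy, (hZ z hz).2]⟩
    exact ⟨i, by simpa using hi, fun j hj => hi' j (by simpa using hj)⟩
  have : Nonempty ι := ⟨i₀⟩
  choose! p hp hp' using hmax
  refine Finset.card_le_card_of_injOn (fun z => Int.fract (y (p z))) (fun z _ => hV _) ?_
  have key : ∀ z ∈ Z, ∀ i, z i = ⌊y i⌋ ↔ Int.fract (y i) ≤ Int.fract (y (p z)) := by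
    refine fun z hz i => ⟨hp' z hz i, fun hle => ?_⟩
    refine ((hZ z hz).1.eq_or hy (hZ z hz).2 i).resolve_right fun h => ?_
    have := (hZ z hz).1 (p z) i
    rw [hp z hz, h] at this
    simp only [Int.fract] at hle
    push_cast at this
    linarith
  intro z hz z' hz' hzz'
  ext i
  have h1 := key z hz i
  have h2 := key z' hz' i
  simp only at hzz'
  rw [hzz', ← h2] at h1
  rcases (hZ z hz).1.eq_or hy (hZ z hz).2 i with h | h <;>
  rcases (hZ z' hz').1.eq_or hy (hZ z' hz').2 i with h' | h' <;> omega

variable {m : ℕ}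

/-- The partial sums of a vector, scaled by `k`. -/
def scaledPartialSum (k : ℕ) (w : Fin m → ℝ) (i : Fin (m + 1)) : ℝ :=
  k * ∑ j : Fin m, if j.castSucc < i then w j else 0

lemma continuous_scaledPartialSum (k : ℕ) (i : Fin (m + 1)) :
    Continuous fun w : Fin m → ℝ => scaledPartialSum k w i := by
  unfold scaledPartialSum
  refine continuous_const.mul (continuous_finsetSum _ fun j _ => ?_)
  split_ifs <;> fun_prop

lemma scaledPartialSum_zero (k : ℕ) (w : Fin m → ℝ) : scaledPartialSum k w 0 = 0 := by
  simp [scaledPartialSum]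

lemma scaledPartialSum_last (k : ℕ) (w : Fin m → ℝ) :
    scaledPartialSum k w (Fin.last m) = k * ∑ j, w j := by
  simp [scaledPartialSum, Fin.castSucc_lt_last]

lemma scaledPartialSum_succ (k : ℕ) (w : Fin m → ℝ) (j : Fin m) :
    scaledPartialSum k w j.succ = scaledPartialSum k w j.castSucc + k * w j := by
  unfold scaledPartialSum
  rw [← mul_add]
  congr 1
  have : w j = ∑ i : Fin m, if i = j then w j else 0 := by simp
  conv_rhs => rw [this]
  rw [← Finset.sum_add_distrib]
  refine Finset.sum_congr rfl fun i _ => ?_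
  simp only [Fin.castSucc_lt_succ_iff, Fin.castSucc_lt_castSucc_iff]
  rcases lt_trichotomy i j with h | h | h
  · simp [h, h.le, h.ne]
  · simp [h]
  · simp [h.not_ge, h.not_gt, h.ne']

lemma scaledPartialSum_mem_Icc (k : ℕ) {w : Fin m → ℝ} (hw : w ∈ stdSimplex ℝ (Fin m))
    (i : Fin (m + 1)) : scaledPartialSum k w i ∈ Icc (0 : ℝ) k := by
  constructor
  · refine mul_nonneg (by positivity) (Finset.sum_nonneg fun j _ => ?_)
    split_ifs
    exacts [hw.1 j, le_rfl]
  · calc scaledPartialSum k w i ≤ k * ∑ j, w j := by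
          refine mul_le_mul_of_nonneg_left (Finset.sum_le_sum fun j _ => ?_) (by positivity)
          split_ifs
          exacts [le_rfl, hw.1 j]
      _ = k := by rw [hw.2, mul_one]

/-- Partial sums change only across vertices of `s`. The initial value `0` costs no extra fractional
part: past the last vertex of `s` the sum is the integer `k`. This gives multiplicity `s.card` and
not `s.card + 1`. -/
lemma fract_scaledPartialSum_mem (k : ℕ) {w : Fin m → ℝ} (hw : w ∈ stdSimplex ℝ (Fin m))
    {s : Finset (Fin m)} (hs : ∀ i ∉ s, w i = 0) (i : Fin (m + 1)) :
    Int.fract (scaledPartialSum k w i) ∈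
      s.image fun j => Int.fract (scaledPartialSum k w j.succ) := by
  have hlast : ∃ j ∈ s, Int.fract (scaledPartialSum k w j.succ) = 0 := by
    have hne : s.Nonempty := by
      rw [Finset.nonempty_iff_ne_empty]
      rintro rfl
      have := hw.2
      simp [hs] at this
    refine ⟨s.max' hne, s.max'_mem hne, ?_⟩
    have : scaledPartialSum k w (s.max' hne).succ = scaledPartialSum k w (Fin.last m) := by
      unfold scaledPartialSum
      congr 1
      refine Finset.sum_congr rfl fun j _ => ?_
      by_cases hj : j ∈ s
      · have : j.castSucc < (s.max' hne).succ :=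
          Fin.castSucc_lt_succ_iff.2 (s.le_max' j hj)
        simp [this, Fin.castSucc_lt_last]
      · simp [hs j hj]
    rw [this, scaledPartialSum_last, hw.2, mul_one, Int.fract_natCast]
  rw [Finset.mem_image]
  induction i using Fin.induction with
  | zero =>
    obtain ⟨j, hj, h⟩ := hlast
    exact ⟨j, hj, by rw [h, scaledPartialSum_zero, Int.fract_zero]⟩
  | succ j ih =>
    by_cases hj : j ∈ s
    · exact ⟨j, hj, rfl⟩
    · rw [scaledPartialSum_succ, hs j hj, mul_zero, add_zero]
      exact ih

/-- The point of the standard simplex with given scaled partial sums. -/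
noncomputable def latticePoint (k : ℕ) (z : Fin (m + 1) → ℤ) (j : Fin m) : ℝ :=
  ((z j.succ - z j.castSucc : ℤ) : ℝ) / k

lemma sum_latticePoint (k : ℕ) (z : Fin (m + 1) → ℤ) :
    ∑ j, latticePoint k z j = ((z (Fin.last m) - z 0 : ℤ) : ℝ) / k := by
  unfold latticePoint
  rw [← Finset.sum_div, ← Int.cast_sum]
  congr 2
  induction m with
  | zero => simp
  | succ m ih =>
    rw [Fin.sum_univ_castSucc]
    have := ih (fun i => z i.castSucc)
    simp only [Fin.succ_castSucc] at this ⊢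
    rw [this]
    simp

lemma IsFreudenthalVertex.abs_sub_latticePoint_lt {k : ℕ} (hk : 0 < k) {w : Fin m → ℝ} {z : Fin (m + 1) → ℤ}
    (h : IsFreudenthalVertex (scaledPartialSum k w) z) (j : Fin m) :
    |w j - latticePoint k z j| < 1 / k := by
  have hk' : (0 : ℝ) < k := by exact_mod_cast hk
  have h1 := h j.succ j.castSucc
  have h2 := h j.castSucc j.succ
  rw [scaledPartialSum_succ] at h1 h2
  have : w j - latticePoint k z j = (k * w j - (z j.succ - z j.castSucc : ℤ)) / k := by
    unfold latticePoint; field_simp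
  rw [this, abs_div, abs_of_pos hk']
  refine div_lt_div_of_pos_right ?_ hk'
  rw [abs_lt]
  push_cast
  constructor <;> linarith

lemma IsFreudenthalVertex.latticePoint_nonneg {k : ℕ} (hk : 0 < k) {w : Fin m → ℝ} {z : Fin (m + 1) → ℤ}
    (h : IsFreudenthalVertex (scaledPartialSum k w) z) (hw : w ∈ stdSimplex ℝ (Fin m)) (j : Fin m) :
    0 ≤ latticePoint k z j := by
  have hk' : (0 : ℝ) < k := by exact_mod_cast hk
  refine div_nonneg ?_ hk'.le
  have h1 := h j.succ j.castSucc
  rw [scaledPartialSum_succ] at h1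
  have h0 := mul_nonneg hk'.le (hw.1 j)
  have : ((-1 : ℤ) : ℝ) < ((z j.succ - z j.castSucc : ℤ) : ℝ) := by push_cast; linarith
  have := Int.cast_lt.1 this
  exact_mod_cast (by omega : 0 ≤ z j.succ - z j.castSucc)

/-- Where `w j = 0`, consecutive partial sums agree, so the integer `z j.succ - z j.castSucc` has
absolute value less than one. Hence rounding never leaves a face. -/
lemma IsFreudenthalVertex.latticePoint_eq_zero {k : ℕ} {w : Fin m → ℝ} {z : Fin (m + 1) → ℤ}
    (h : IsFreudenthalVertex (scaledPartialSum k w) z) {j : Fin m} (hj : w j = 0) :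
    latticePoint k z j = 0 := by
  have h1 := h j.succ j.castSucc
  have h2 := h j.castSucc j.succ
  rw [scaledPartialSum_succ, hj, mul_zero] at h1 h2
  have h3 : ((-1 : ℤ) : ℝ) < ((z j.succ - z j.castSucc : ℤ) : ℝ) := by push_cast; linarith
  have h4 : ((z j.succ - z j.castSucc : ℤ) : ℝ) < ((1 : ℤ) : ℝ) := by push_cast; linarith
  have h3 := Int.cast_lt.1 h3
  have h4 := Int.cast_lt.1 h4
  have : z j.succ - z j.castSucc = 0 := by omega
  simp [latticePoint, this]

lemma IsFreudenthalVertex.latticePoint_mem_stdSimplex {k : ℕ} (hk : 0 < k) {w : Fin m → ℝ} {z : Fin (m + 1) → ℤ}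
    (h : IsFreudenthalVertex (scaledPartialSum k w) z) (hw : w ∈ stdSimplex ℝ (Fin m))
    (hz : z 0 = 0) : latticePoint k z ∈ stdSimplex ℝ (Fin m) := by
  have hk' : (0 : ℝ) < k := by exact_mod_cast hk
  refine ⟨fun j => h.latticePoint_nonneg hk hw j, ?_⟩
  rw [sum_latticePoint, hz]
  have h1 := h (Fin.last m) 0
  have h2 := h 0 (Fin.last m)
  rw [scaledPartialSum_last, scaledPartialSum_zero, hw.2, hz] at h1 h2
  have h3 : ((k - 1 : ℤ) : ℝ) < z (Fin.last m) := by push_cast at *; linarith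
  have h4 : (z (Fin.last m) : ℝ) < ((k + 1 : ℤ) : ℝ) := by push_cast at *; linarith
  have h3 := Int.cast_lt.1 h3
  have h4 := Int.cast_lt.1 h4
  have : z (Fin.last m) = k := by omega
  rw [this]
  simp [hk'.ne']

end Lattice

/-! ### Fine covers of bounded multiplicity -/

/-- A finite simplicial complex has arbitrarily fine finite open covers, given as the positivity
sets of continuous functions, of multiplicity at most the largest size of a face, such that each
member `j` has a central point `x j` which lies in every face that meets the member. -/
theorem exists_fine_cover {m : ℕ} (K : PreAbstractSimplicialComplex (Fin m)) {ε : ℝ} (hε : 0 < ε) :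
    ∃ (M : ℕ) (h : Fin M → (Fin m → ℝ) → ℝ) (x : Fin M → Fin m → ℝ),
      (∀ j, Continuous (h j)) ∧ (∀ j w, 0 ≤ h j w) ∧ (∀ j, x j ∈ realization K) ∧
      (∀ w ∈ realization K, ∃ j, 0 < h j w) ∧
      (∀ w ∈ realization K, ∀ j, 0 < h j w → dist w (x j) < ε ∧ ∀ i, w i = 0 → x j i = 0) ∧
      (∀ n, (∀ s ∈ K.faces, s.card ≤ n) →
        ∀ w ∈ realization K, (Finset.univ.filter fun j => 0 < h j w).card ≤ n) := by
  classical
  obtain ⟨k, hk⟩ := exists_nat_one_div_lt hε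
  replace hk : 1 / ((k + 1 : ℕ) : ℝ) < ε := by exact_mod_cast hk
  have hk0 : 0 < k + 1 := k.succ_pos
  set Z : Set (Fin (m + 1) → ℤ) := {z | z 0 = 0 ∧ ∃ w ∈ realization K,
    IsFreudenthalVertex (scaledPartialSum (k + 1) w) z} with hZdef
  have hZ : Z.Finite := by
    refine (Set.finite_Icc (fun _ => (0 : ℤ)) (fun _ => (k + 1 : ℤ) + 1)).subset ?_
    rintro z ⟨hz, w, hw, h⟩
    have : ∀ i, 0 ≤ z i ∧ z i ≤ (k + 1 : ℤ) + 1 := by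
      intro i
      have hi := scaledPartialSum_mem_Icc (k + 1) hw.1 i
      have h1 : 0 ≤ ⌊scaledPartialSum (k + 1) w i⌋ := Int.floor_nonneg.2 hi.1
      have h2 : ⌊scaledPartialSum (k + 1) w i⌋ ≤ (k + 1 : ℤ) := by
        have := Int.floor_le_floor hi.2
        rwa [Int.floor_natCast] at this
      rcases h.eq_or (scaledPartialSum_zero _ _) hz i with h | h <;> omega
    exact ⟨fun i => (this i).1, fun i => (this i).2⟩
  have := hZ.to_subtype
  obtain ⟨M, ⟨e⟩⟩ := Finite.exists_equiv_fin Z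
  -- A product of positive parts is positive exactly when all the strict inequalities defining a
  -- Freudenthal vertex hold, so its positivity set is the open star of `z`.
  let g : (Fin (m + 1) → ℤ) → (Fin m → ℝ) → ℝ := fun z w => ∏ i, ∏ j,
    max 0 (1 - ((scaledPartialSum (k + 1) w i - z i) - (scaledPartialSum (k + 1) w j - z j)))
  have hg0 : ∀ z w, 0 ≤ g z w := fun z w =>
    Finset.prod_nonneg fun i _ => Finset.prod_nonneg fun j _ => le_max_left _ _
  have hg : ∀ z w, 0 < g z w ↔ IsFreudenthalVertex (scaledPartialSum (k + 1) w) z := by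
    refine fun z w => ⟨fun h i j => ?_, fun h => ?_⟩
    · by_contra! hij
      refine h.ne' (Finset.prod_eq_zero (Finset.mem_univ i)
        (Finset.prod_eq_zero (Finset.mem_univ j) (max_eq_left ?_)))
      linarith
    · refine Finset.prod_pos fun i _ => Finset.prod_pos fun j _ => lt_max_of_lt_right ?_
      linarith [h i j]
  refine ⟨M, fun j => g (e.symm j).1, fun j => latticePoint (k + 1) (e.symm j).1, ?_, ?_, ?_, ?_,
    ?_, ?_⟩
  · intro j
    refine continuous_finsetProd _ fun i _ => continuous_finsetProd _ fun j _ => ?_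
    have := continuous_scaledPartialSum (m := m) (k + 1) i
    have := continuous_scaledPartialSum (m := m) (k + 1) j
    fun_prop
  · exact fun j w => hg0 _ _
  · intro j
    obtain ⟨hz, w, hw, h⟩ := (e.symm j).2
    refine ⟨h.latticePoint_mem_stdSimplex hk0 hw.1 hz, ?_⟩
    obtain ⟨s, hs, hws⟩ := hw.2
    exact ⟨s, hs, fun i hi => h.latticePoint_eq_zero (hws i hi)⟩
  -- Rounding every partial sum down gives a vertex, because fractional parts differ by less than
  -- one.
  · intro w hw
    have h : IsFreudenthalVertex (scaledPartialSum (k + 1) w)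
        fun i => ⌊scaledPartialSum (k + 1) w i⌋ := by
      intro i j
      have := Int.fract_lt_one (scaledPartialSum (k + 1) w i)
      have := Int.fract_nonneg (scaledPartialSum (k + 1) w j)
      simp only [Int.fract] at *
      linarith
    refine ⟨e ⟨_, by simp [scaledPartialSum_zero], w, hw, h⟩, ?_⟩
    simp only [Equiv.symm_apply_apply]
    exact (hg _ _).2 h
  · intro w hw j hj
    have h := (hg _ _).1 hj
    refine ⟨(dist_pi_lt_iff hε).2 fun i => ?_, fun i hi => h.latticePoint_eq_zero hi⟩
    exact (h.abs_sub_latticePoint_lt hk0 i).trans hk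
  · intro n hn w hw
    obtain ⟨s, hs, hws⟩ := hw.2
    refine le_trans ?_ (hn s hs)
    refine le_trans ?_ (Finset.card_image_le
      (f := fun j : Fin m => Int.fract (scaledPartialSum (k + 1) w j.succ)))
    rw [← Finset.card_image_of_injective (Finset.univ.filter fun j => 0 < g (e.symm j).1 w)
      (Subtype.val_injective.comp e.symm.injective)]
    refine card_isFreudenthalVertex_le (scaledPartialSum_zero (k + 1) w) _ ?_ _
      (fract_scaledPartialSum_mem (k + 1) hw.1 hws)
    intro z hz
    simp only [Finset.mem_image, Finset.mem_filter, Finset.mem_univ, true_and] at hz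
    obtain ⟨j, hj, rfl⟩ := hz
    exact ⟨(hg _ _).1 hj, (e.symm j).2.1⟩

/-! ### Filling spheres in a space with a trivial homotopy group -/

section Fill

/-- A continuous map on a compact space descends along a continuous map to a Hausdorff space. -/
lemma exists_continuousOn_range {Y E K : Type*} [TopologicalSpace Y] [CompactSpace Y]
    [TopologicalSpace E] [T2Space E] [TopologicalSpace K] [Nonempty K] {Θ : Y → E}
    (hΘ : Continuous Θ) {H : Y → K} (hH : Continuous H) (hfac : H.FactorsThrough Θ) :
    ∃ G : E → K, ContinuousOn G (range Θ) ∧ ∀ y, G (Θ y) = H y := by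
  have hG : ∀ y, Function.extend Θ H (fun _ => Classical.arbitrary K) (Θ y) = H y :=
    fun y => hfac.extend_apply _ y
  refine ⟨Function.extend Θ H (fun _ => Classical.arbitrary K), ?_, hG⟩
  rw [continuousOn_iff_continuous_domRestrict]
  have hq : IsQuotientMap (rangeFactorization Θ) :=
    (hΘ.rangeFactorization.isClosedMap).isQuotientMap hΘ.rangeFactorization
      rangeFactorization_surjective
  rw [hq.continuous_iff]
  exact hH.congr fun y => (hG y).symm

/-- An open embedding into a Hausdorff space extends to a collapse onto the one-point
compactification. -/
lemma exists_collapse {E Y : Type*} [TopologicalSpace E] [TopologicalSpace Y] [T2Space Y]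
    {j : E → Y} (hj : IsOpenEmbedding j) :
    ∃ c : Y → OnePoint E, Continuous c ∧ (∀ x, c (j x) = x) ∧ ∀ y ∉ range j, c y = OnePoint.infty := by
  have h1 : ∀ x, Function.extend j (fun x => (x : OnePoint E)) (fun _ => OnePoint.infty) (j x) = x :=
    fun x => hj.injective.extend_apply _ _ x
  have h2 : ∀ y ∉ range j,
      Function.extend j (fun x => (x : OnePoint E)) (fun _ => OnePoint.infty) y = OnePoint.infty :=
    fun y hy => Function.extend_apply' _ _ _ hy
  refine ⟨_, ?_, h1, h2⟩
  set c := Function.extend j (fun x => (x : OnePoint E)) (fun _ => OnePoint.infty)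
  rw [continuous_def]
  intro s hs
  by_cases hinf : OnePoint.infty ∈ s
  -- A neighbourhood of infinity misses only a compact set, whose image in the Hausdorff space `Y`
  -- is closed.
  · have : c ⁻¹' s = (j '' ((↑) ⁻¹' s : Set E)ᶜ)ᶜ := by
      ext y
      by_cases hy : y ∈ range j
      · obtain ⟨x, rfl⟩ := hy
        simp [h1, hj.injective.eq_iff]
      · simp only [mem_preimage, h2 y hy, hinf, true_iff, mem_compl_iff]
        rintro ⟨x, -, rfl⟩
        exact hy ⟨x, rfl⟩
    rw [this, isOpen_compl_iff]
    exact ((((OnePoint.isOpen_iff_of_mem' hinf).1 hs).1).image hj.continuous).isClosed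
  · have : c ⁻¹' s = j '' ((↑) ⁻¹' s : Set E) := by
      ext y
      by_cases hy : y ∈ range j
      · obtain ⟨x, rfl⟩ := hy
        simp [h1, hj.injective.eq_iff]
      · simp only [mem_preimage, h2 y hy, hinf, false_iff]
        rintro ⟨x, -, rfl⟩
        exact hy ⟨x, rfl⟩
    rw [this]
    exact hj.isOpenMap _ ((OnePoint.isOpen_iff_of_notMem hinf).1 hs)

/-- The sphere is the quotient of a cube by its boundary. -/
lemma exists_cube_to_sphere (i : ℕ) (hi : 1 ≤ i) :
    ∃ (q : (Fin i → I) → EuclideanSpace ℝ (Fin (i + 1))) (p : EuclideanSpace ℝ (Fin (i + 1))),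
      Continuous q ∧ range q = Metric.sphere 0 1 ∧ (∀ y ∈ Cube.boundary (Fin i), q y = p) ∧
      ∀ y y', q y = q y' → y = y' ∨ (y ∈ Cube.boundary (Fin i) ∧ y' ∈ Cube.boundary (Fin i)) := by
  -- The sigmoid identifies `ℝ^i` with the open cube; collapsing the boundary gives the one-point
  -- compactification of `ℝ^i`, which is the sphere. The point at infinity is attained because the
  -- boundary is nonempty for `i ≥ 1`.
  have hs : IsOpenEmbedding unitInterval.sigmoid :=
    ⟨isEmbedding_sigmoid, by rw [unitInterval.range_sigmoid]; exact isOpen_Ioo⟩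
  have hj : IsOpenEmbedding (Pi.map fun (_ : Fin i) => unitInterval.sigmoid) :=
    IsOpenEmbedding.piMap fun _ => hs
  have hr : ∀ y : Fin i → I, y ∈ range (Pi.map fun (_ : Fin i) => unitInterval.sigmoid) ↔
      y ∉ Cube.boundary (Fin i) := by
    intro y
    rw [range_piMap, unitInterval.range_sigmoid]
    simp only [Set.mem_pi, mem_univ, true_imp_iff, mem_Ioo, Cube.boundary, mem_ofPred_eq,
      not_exists, not_or, unitInterval.pos_iff_ne_zero, unitInterval.lt_one_iff_ne_one, ne_eq]
  obtain ⟨c, hc, hcj, hcinf⟩ := exists_collapse hj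
  let h : OnePoint (Fin i → ℝ) ≃ₜ Metric.sphere (0 : EuclideanSpace ℝ (Fin (i + 1))) 1 :=
    onePointEquivSphereOfFinrankEq (by simp)
  have hb : ∀ y ∈ Cube.boundary (Fin i), c y = OnePoint.infty :=
    fun y hy => hcinf y fun h => (hr y).1 h hy
  refine ⟨fun y => h (c y), h OnePoint.infty, by fun_prop, ?_, fun y hy => by simp only [hb y hy], ?_⟩
  · apply Subset.antisymm
    · rintro _ ⟨y, rfl⟩
      exact (h (c y)).2
    · intro z hz
      obtain ⟨x, hx⟩ := h.surjective ⟨z, hz⟩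
      have : ∃ y, c y = x := by
        induction x using OnePoint.rec with
        | infty => exact ⟨fun _ => 0, hb _ ⟨⟨0, hi⟩, Or.inl rfl⟩⟩
        | coe x => exact ⟨_, hcj x⟩
      obtain ⟨y, hy⟩ := this
      exact ⟨y, by simp [hy, hx]⟩
  · intro y y' hyy'
    have hcc : c y = c y' := h.injective (Subtype.ext hyy')
    by_cases hy : y ∈ Cube.boundary (Fin i)
    · by_cases hy' : y' ∈ Cube.boundary (Fin i)
      · exact Or.inr ⟨hy, hy'⟩
      · obtain ⟨x', rfl⟩ := (hr y').2 hy'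
        rw [hb y hy, hcj] at hcc
        exact absurd hcc (OnePoint.infty_ne_coe _)
    · obtain ⟨x, rfl⟩ := (hr y).2 hy
      by_cases hy' : y' ∈ Cube.boundary (Fin i)
      · rw [hb y' hy', hcj] at hcc
        exact absurd hcc (OnePoint.coe_ne_infty _)
      · obtain ⟨x', rfl⟩ := (hr y').2 hy'
        rw [hcj, hcj] at hcc
        exact Or.inl (by rw [OnePoint.coe_injective hcc])

/-- If `π_i(K)` is trivial, then maps to `K` extend from the boundary of an `(i+1)`-dimensional
convex body to the body. -/
theorem exists_extension_convexBody {K : Type*} [TopologicalSpace K] {i : ℕ} (hi : 1 ≤ i)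
    (hK : ∀ k : K, Subsingleton (HomotopyGroup (Fin i) K k))
    {S : Set (EuclideanSpace ℝ (Fin (i + 1)))} (hS : Convex ℝ S) (hSc : IsCompact S)
    (hSi : (interior S).Nonempty) {f : EuclideanSpace ℝ (Fin (i + 1)) → K}
    (hf : ContinuousOn f (frontier S)) :
    ∃ G : EuclideanSpace ℝ (Fin (i + 1)) → K, ContinuousOn G S ∧ EqOn G f (frontier S) := by
  obtain ⟨e, -, he2, he3⟩ :=
    exists_homeomorph_image_interior_closure_frontier_eq_unitBall hS hSi hSc.isBounded
  rw [hSc.isClosed.closure_eq] at he2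
  obtain ⟨q, p, hq, hqr, hqb, hqi⟩ := exists_cube_to_sphere i hi
  have hesymm : ∀ y, e.symm (q y) ∈ frontier S := by
    intro y
    have : q y ∈ e '' frontier S := by rw [he3, ← hqr]; exact mem_range_self y
    obtain ⟨x, hx, hxy⟩ := this
    rw [← hxy, e.symm_apply_apply]
    exact hx
  have hgc : Continuous fun y => f (e.symm (q y)) :=
    hf.comp_continuous (e.symm.continuous.comp hq) hesymm
  let g : GenLoop (Fin i) K (f (e.symm p)) := ⟨⟨_, hgc⟩, fun y hy => by simp [hqb y hy]⟩
  have hg : GenLoop.Homotopic (GenLoop.const) g := by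
    have := hK (f (e.symm p))
    exact Quotient.exact (s := GenLoop.Homotopic.setoid (Fin i) _)
      (Subsingleton.elim (α := HomotopyGroup (Fin i) K _) _ _)
  obtain ⟨H⟩ := hg
  have hnorm : ∀ y, ‖q y‖ = 1 := by
    intro y
    have : q y ∈ Metric.sphere 0 1 := by rw [← hqr]; exact mem_range_self y
    simpa using this
  have : Nonempty K := ⟨f 0⟩
  -- Polar coordinates on the body: the cube wraps around the sphere and `t` is the radius. They
  -- identify points only at `t = 0` and on the boundary of the cube, and there the homotopy `H`,
  -- which starts at the constant loop, takes the base value.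
  obtain ⟨G, hG, hGH⟩ := exists_continuousOn_range
    (Θ := fun x : I × (Fin i → I) => e.symm ((x.1 : ℝ) • q x.2)) (H := H)
    (by fun_prop) H.continuous (by
      rintro ⟨t, y⟩ ⟨t', y'⟩ h
      have h := e.symm.injective h
      simp only at h
      have ht : t = t' := by
        have := congrArg norm h
        rw [norm_smul, norm_smul, hnorm, hnorm, mul_one, mul_one, Real.norm_eq_abs,
          Real.norm_eq_abs, abs_of_nonneg t.2.1, abs_of_nonneg t'.2.1] at this
        exact Subtype.ext this
      subst ht
      by_cases h0 : t = 0
      · subst h0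
        rw [H.apply_zero, H.apply_zero]
        rfl
      · have h0' : (t : ℝ) ≠ 0 := fun h => h0 (Subtype.ext h)
        have hyy' := smul_right_injective _ h0' h
        rcases hqi _ _ hyy' with h | ⟨h, h'⟩
        · rw [h]
        · rw [H.eq_fst t h, H.eq_fst t h']
          rfl)
  have hrange : range (fun x : I × (Fin i → I) => e.symm ((x.1 : ℝ) • q x.2)) = S := by
    apply Subset.antisymm
    · rintro _ ⟨⟨t, y⟩, rfl⟩
      have : (t : ℝ) • q y ∈ e '' S := by
        rw [he2, mem_closedBall_zero_iff, norm_smul, hnorm, mul_one, Real.norm_eq_abs,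
          abs_of_nonneg t.2.1]
        exact t.2.2
      obtain ⟨x, hx, hxy⟩ := this
      simp only
      rw [← hxy, e.symm_apply_apply]
      exact hx
    · intro x hx
      have hx' : e x ∈ Metric.closedBall 0 1 := by rw [← he2]; exact mem_image_of_mem e hx
      rw [mem_closedBall_zero_iff] at hx'
      rcases eq_or_ne (e x) 0 with h0 | h0
      · exact ⟨⟨0, fun _ => 0⟩, by simp [← h0]⟩
      · have : ‖e x‖⁻¹ • e x ∈ range q := by
          rw [hqr, mem_sphere_zero_iff_norm, norm_smul, norm_inv, norm_norm,
            inv_mul_cancel₀ (norm_ne_zero_iff.2 h0)]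
        obtain ⟨y, hy⟩ := this
        refine ⟨⟨⟨‖e x‖, norm_nonneg _, hx'⟩, y⟩, ?_⟩
        simp only
        rw [hy, smul_smul, mul_inv_cancel₀ (norm_ne_zero_iff.2 h0), one_smul, e.symm_apply_apply]
  rw [hrange] at hG
  refine ⟨G, hG, fun x hx => ?_⟩
  have : e x ∈ range q := by rw [hqr, ← he3]; exact mem_image_of_mem e hx
  obtain ⟨y, hy⟩ := this
  have h1 := hGH (1, y)
  rw [H.apply_one] at h1
  simp only [Icc.coe_one, one_smul, hy, e.symm_apply_apply] at h1
  rw [h1]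
  change f (e.symm (q y)) = f x
  rw [hy, e.symm_apply_apply]


/-! ### Filling single simplices -/

section Face

variable {V : Type*} [Fintype V]

/-- The closed simplex spanned by a set of vertices. -/
def closedFace (τ : Finset V) : Set (V → ℝ) :=
  {w | w ∈ stdSimplex ℝ V ∧ ∀ i ∉ τ, w i = 0}

/-- The boundary of the closed simplex spanned by a set of vertices. -/
def faceBoundary (τ : Finset V) : Set (V → ℝ) :=
  {w | w ∈ closedFace τ ∧ ∃ i ∈ τ, w i = 0}

lemma isCompact_closedFace (τ : Finset V) : IsCompact (closedFace τ) := by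
  refine (isCompact_stdSimplex ℝ V).inter_right (t := {w | ∀ i ∉ τ, w i = 0}) ?_
  simp only [ofPred_forall]
  exact isClosed_iInter fun i => isClosed_iInter fun _ =>
    isClosed_eq (continuous_apply i) continuous_const

lemma convex_closedFace (τ : Finset V) : Convex ℝ (closedFace τ) := by
  rintro w ⟨hw, hw'⟩ w' ⟨hv, hv'⟩ a b ha hb hab
  refine ⟨convex_stdSimplex ℝ V hw hv ha hb hab, fun i hi => ?_⟩
  simp [hw' i hi, hv' i hi]

lemma sum_eq_of_forall_notMem {τ : Finset V} {w : V → ℝ} (h : ∀ i ∉ τ, w i = 0) :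
    ∑ i, w i = ∑ i ∈ τ, w i :=
  (Finset.sum_subset (Finset.subset_univ τ) fun i _ hi => h i hi).symm

variable [DecidableEq V]

/-- If `π_i(K)` is trivial, then maps to `K` extend from the boundary of an `(i+1)`-simplex to the
simplex. -/
theorem exists_extension_closedFace {K : Type*} [TopologicalSpace K] {i : ℕ} (hi : 1 ≤ i)
    (hK : ∀ k : K, Subsingleton (HomotopyGroup (Fin i) K k)) {τ : Finset V}
    (hτ : τ.card = i + 2) {F : (V → ℝ) → K} (hF : ContinuousOn F (faceBoundary τ)) :
    ∃ G : (V → ℝ) → K, ContinuousOn G (closedFace τ) ∧ EqOn G F (faceBoundary τ) := by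
  have hne : τ.Nonempty := Finset.card_pos.1 (by omega)
  obtain ⟨v₀, hv₀⟩ := hne
  have hcard : Fintype.card (Fin (i + 1)) = Fintype.card (τ.erase v₀) := by
    rw [Fintype.card_coe, Finset.card_erase_of_mem hv₀, hτ, Fintype.card_fin]
    omega
  let e : Fin (i + 1) ≃ τ.erase v₀ := Fintype.equivOfCardEq hcard
  -- Dropping the coordinate of `v₀` turns the simplex into a convex body of full dimension; `B`
  -- recovers that coordinate from the sum being one.
  let A : (V → ℝ) →L[ℝ] EuclideanSpace ℝ (Fin (i + 1)) :=
    (EuclideanSpace.equiv (Fin (i + 1)) ℝ).symm.toContinuousLinearMap.comp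
      (ContinuousLinearMap.pi fun j => ContinuousLinearMap.proj (e j : V))
  have hA : ∀ w j, A w j = w (e j) := fun w j => rfl
  let B : EuclideanSpace ℝ (Fin (i + 1)) → V → ℝ := fun x v =>
    if h : v ∈ τ.erase v₀ then x (e.symm ⟨v, h⟩) else if v = v₀ then 1 - ∑ j, x j else 0
  have hBe : ∀ x j, B x (e j) = x j := by
    intro x j
    simp only [B]
    rw [dif_pos (e j).2]
    simp
  have hB0 : ∀ x, B x v₀ = 1 - ∑ j, x j := fun x => by simp [B]
  have hBn : ∀ x, ∀ v ∉ τ, B x v = 0 := by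
    intro x v hv
    have : v ≠ v₀ := fun h => hv (h ▸ hv₀)
    simp [B, hv, this]
  have hBc : Continuous B := by
    refine continuous_pi fun v => ?_
    simp only [B]
    split_ifs <;> fun_prop
  have hsum : ∀ w : V → ℝ, (∀ v ∉ τ, w v = 0) → ∑ v, w v = w v₀ + ∑ j, w (e j) := by
    intro w hw
    rw [sum_eq_of_forall_notMem hw, ← Finset.add_sum_erase _ _ hv₀,
      ← Finset.sum_coe_sort (τ.erase v₀), ← e.sum_comp]
  have hBA : ∀ w : V → ℝ, (∀ v ∉ τ, w v = 0) → ∑ v, w v = 1 → B (A w) = w := by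
    intro w hw hw1
    ext v
    by_cases hv : v ∈ τ
    · by_cases hvv : v = v₀
      · rw [hvv, hB0]
        rw [hsum w hw] at hw1
        simp only [hA]
        linarith
      · obtain ⟨j, hj⟩ := e.surjective ⟨v, Finset.mem_erase.2 ⟨hvv, hv⟩⟩
        have : v = e j := by rw [hj]
        rw [this, hBe, hA]
    · rw [hBn _ v hv, hw v hv]
  have hB1 : ∀ x, ∑ v, B x v = 1 := by
    intro x
    rw [hsum _ (hBn x), hB0]
    simp [hBe]
  have hAB : ∀ x, A (B x) = x := fun x => by ext j; rw [hA, hBe]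
  set S := A '' closedFace τ with hSdef
  have hBS : ∀ x ∈ S, B x ∈ closedFace τ := by
    rintro _ ⟨w, hw, rfl⟩
    rwa [hBA w hw.2 hw.1.2]
  have hSc : IsCompact S := (isCompact_closedFace τ).image A.continuous
  have hU : ∀ x, (∀ v ∈ τ, 0 < B x v) → x ∈ interior S := by
    intro x hx
    have hopen : IsOpen {x | ∀ v ∈ τ, 0 < B x v} := by
      have : {x | ∀ v ∈ τ, 0 < B x v} = ⋂ v ∈ τ, {x | 0 < B x v} := by ext; simp
      rw [this]
      exact isOpen_biInter_finset fun v _ =>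
        isOpen_lt continuous_const ((continuous_apply v).comp hBc)
    refine interior_maximal ?_ hopen hx
    intro y hy
    refine ⟨B y, ⟨⟨fun v => ?_, hB1 y⟩, hBn y⟩, hAB y⟩
    by_cases hv : v ∈ τ
    · exact (hy v hv).le
    · rw [hBn y v hv]
  have hτ0 : (0 : ℝ) < τ.card := by rw [hτ]; positivity
  let c : V → ℝ := fun v => if v ∈ τ then 1 / (τ.card : ℝ) else 0
  have hcn : ∀ v ∉ τ, c v = 0 := fun v hv => by simp [c, hv]
  have hc1 : ∑ v, c v = 1 := by
    rw [sum_eq_of_forall_notMem hcn, Finset.sum_congr rfl fun v hv => if_pos hv]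
    simp [hτ0.ne']
  have hcpos : ∀ v ∈ τ, 0 < c v := fun v hv => by simp only [c, if_pos hv]; positivity
  have hfr : ∀ w ∈ faceBoundary τ, A w ∈ frontier S := by
    rintro w ⟨hw, v, hv, hwv⟩
    rw [hSc.isClosed.frontier_eq]
    refine ⟨mem_image_of_mem A hw, fun hint => ?_⟩
    -- Moving from `w` away from the barycentre `c` makes the vanishing coordinate negative at once,
    -- so `A w` is not interior.
    have hcont : Continuous fun t : ℝ => A (w + t • (w - c)) := by fun_prop
    have h0 : (fun t : ℝ => A (w + t • (w - c))) 0 ∈ interior S := by simpa using hint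
    have hev : ∀ᶠ t in 𝓝[>] (0 : ℝ), A (w + t • (w - c)) ∈ interior S :=
      (hcont.continuousAt.eventually (isOpen_interior.mem_nhds h0)).filter_mono nhdsWithin_le_nhds
    obtain ⟨t, ht, ht0⟩ := (hev.and self_mem_nhdsWithin).exists
    have := hBS _ (interior_subset ht)
    rw [hBA] at this
    · have h2 := this.1.1 v
      simp only [Pi.add_apply, Pi.smul_apply, Pi.sub_apply, hwv, smul_eq_mul] at h2
      have := mul_pos (show (0 : ℝ) < t from ht0) (hcpos v hv)
      linarith
    · intro v hv
      simp [hw.2 v hv, hcn v hv]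
    · simp [Finset.sum_add_distrib, ← Finset.mul_sum, hw.1.2, hc1]
  have hfB : MapsTo B (frontier S) (faceBoundary τ) := by
    intro x hx
    rw [hSc.isClosed.frontier_eq] at hx
    refine ⟨hBS x hx.1, ?_⟩
    by_contra! hpos
    exact hx.2 (hU x fun v hv => lt_of_le_of_ne ((hBS x hx.1).1.1 v) (hpos v hv).symm)
  obtain ⟨G, hG, hGF⟩ := exists_extension_convexBody hi hK
    ((convex_closedFace τ).is_linear_image A.toLinearMap.isLinear) hSc
    ⟨A c, hU _ fun v hv => by rw [hBA c hcn hc1]; exact hcpos v hv⟩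
    (hF.comp hBc.continuousOn hfB)
  refine ⟨G ∘ A, hG.comp A.continuous.continuousOn (mapsTo_image A _), fun w hw => ?_⟩
  have := hGF (hfr w hw)
  simp only [Function.comp] at this ⊢
  rw [this, hBA w hw.1.2 hw.1.1.2]

/-- The point of the segment from vertex `a` to vertex `b` with parameter `t`. -/
def edgePoint (a b : V) (t : ℝ) : V → ℝ :=
  (1 - t) • Pi.single a 1 + t • Pi.single b 1

/-- A map on the boundary of a triangle extends to the triangle, if the concatenation of two sides
is homotopic to the third one. -/
theorem exists_extension_triangle {K : Type*} [TopologicalSpace K] {F : (V → ℝ) → K} {a b c : V}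
    (hab : a ≠ b) (hbc : b ≠ c) (hac : a ≠ c) {ka kb kc : K} {p : Path ka kb} {q : Path kb kc}
    {r : Path ka kc} (hp : ∀ t : I, F (edgePoint a b t) = p t)
    (hq : ∀ t : I, F (edgePoint b c t) = q t) (hr : ∀ t : I, F (edgePoint a c t) = r t)
    (h : r.Homotopic (p.trans q)) :
    ∃ G : (V → ℝ) → K, ContinuousOn G (closedFace {a, b, c}) ∧
      EqOn G F (faceBoundary {a, b, c}) := by
  obtain ⟨H⟩ := h
  have : Nonempty K := ⟨ka⟩
  -- `Θ` sweeps the triangle by paths from `a` to `c`: the straight edge at `s = 0`, the broken line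
  -- through `b` at `s = 1`. The time `t` is recovered as `w c + w b / 2`, and only `t = 0` and `t =
  -- 1` are collapsed, where a homotopy of paths is constant.
  let m : ℝ → ℝ := fun t => min t (1 - t)
  let Θ : I × I → V → ℝ := fun x =>
    Pi.single a (1 - x.2 - x.1 * m x.2) + Pi.single b (2 * x.1 * m x.2)
      + Pi.single c (x.2 - x.1 * m x.2 : ℝ)
  have hΘa : ∀ x, Θ x a = 1 - x.2 - x.1 * m x.2 := fun x => by
    simp [Θ, hab, hac]
  have hΘb : ∀ x, Θ x b = 2 * x.1 * m x.2 := fun x => by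
    simp [Θ, hab.symm, hbc]
  have hΘc : ∀ x, Θ x c = x.2 - x.1 * m x.2 := fun x => by
    simp [Θ, hac.symm, hbc.symm]
  have hΘn : ∀ x, ∀ v ∉ ({a, b, c} : Finset V), Θ x v = 0 := fun x v hv => by
    simp only [Finset.mem_insert, Finset.mem_singleton, not_or] at hv
    simp [Θ, hv.1, hv.2.1, hv.2.2]
  have hext : ∀ w w' : V → ℝ, w a = w' a → w b = w' b → w c = w' c →
      (∀ v ∉ ({a, b, c} : Finset V), w v = 0) → (∀ v ∉ ({a, b, c} : Finset V), w' v = 0) →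
      w = w' := by
    intro w w' ha hb hc hn hn'
    ext v
    by_cases hv : v ∈ ({a, b, c} : Finset V)
    · simp only [Finset.mem_insert, Finset.mem_singleton] at hv
      rcases hv with rfl | rfl | rfl <;> assumption
    · rw [hn v hv, hn' v hv]
  have hsum : ∀ w : V → ℝ, (∀ v ∉ ({a, b, c} : Finset V), w v = 0) →
      ∑ v, w v = w a + w b + w c := by
    intro w hw
    rw [sum_eq_of_forall_notMem hw, Finset.sum_insert (by simp [hab, hac]),
      Finset.sum_insert (by simp [hbc]), Finset.sum_singleton, add_assoc]
  have hm0 : ∀ t : I, 0 ≤ m t := fun t => le_min t.2.1 (by linarith [t.2.2])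
  have hm1 : ∀ t : ℝ, m t ≤ t := fun t => min_le_left _ _
  have hm2 : ∀ t : ℝ, m t ≤ 1 - t := fun t => min_le_right _ _
  obtain ⟨G, hG, hGH⟩ := exists_continuousOn_range (Θ := Θ) (H := H)
    (by
      have hmc : Continuous m := by fun_prop
      have hsg : ∀ v : V, Continuous fun t : ℝ => (Pi.single v t : V → ℝ) :=
        fun v => continuous_single (A := fun _ : V => ℝ) v
      refine ((((hsg a).comp ?_).add ((hsg b).comp ?_)).add ((hsg c).comp ?_)) <;> fun_prop)
    H.continuous (by
      rintro ⟨s, t⟩ ⟨s', t'⟩ hxy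
      have hb := congrFun hxy b
      have hc := congrFun hxy c
      rw [hΘb, hΘb] at hb
      rw [hΘc, hΘc] at hc
      simp only at hb hc
      have ht : t = t' := Subtype.ext (by linarith)
      subst ht
      by_cases h0 : t = 0
      · subst h0
        rw [Path.Homotopy.source, Path.Homotopy.source]
      by_cases h1 : t = 1
      · subst h1
        rw [Path.Homotopy.target, Path.Homotopy.target]
      have hmt : 0 < m t := lt_min (unitInterval.pos_iff_ne_zero.2 h0)
        (sub_pos.2 (unitInterval.lt_one_iff_ne_one.2 h1))
      have hs : s = s' := by
        refine Subtype.ext ?_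
        have : (2 * (s : ℝ) - 2 * s') * m t = 0 := by linarith
        rcases mul_eq_zero.1 this with h | h
        · linarith
        · exact absurd h hmt.ne'
      rw [hs])
  have hrange : range Θ = closedFace {a, b, c} := by
    apply Subset.antisymm
    · rintro _ ⟨⟨s, t⟩, rfl⟩
      refine ⟨⟨fun v => ?_, ?_⟩, hΘn _⟩
      · have hsm : (s : ℝ) * m t ≤ m t := mul_le_of_le_one_left (hm0 t) s.2.2
        have hsm0 : 0 ≤ (s : ℝ) * m t := mul_nonneg s.2.1 (hm0 t)
        by_cases hv : v ∈ ({a, b, c} : Finset V)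
        · simp only [Finset.mem_insert, Finset.mem_singleton] at hv
          rcases hv with rfl | rfl | rfl
          · rw [hΘa]; simp only; linarith [hm2 t]
          · rw [hΘb]; simp only; linarith
          · rw [hΘc]; simp only; linarith [hm1 t]
        · rw [hΘn _ v hv]
      · rw [hsum _ (hΘn _), hΘa, hΘb, hΘc]
        ring
    · rintro w ⟨hw, hwn⟩
      have h1 := hw.2
      rw [hsum w hwn] at h1
      have ha := hw.1 a
      have hb := hw.1 b
      have hc := hw.1 c
      have hbm : w b ≤ 2 * m (w c + w b / 2) := by
        have : w b / 2 ≤ m (w c + w b / 2) := le_min (by linarith) (by linarith)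
        linarith
      obtain ⟨s, hs⟩ : ∃ s : I, 2 * (s : ℝ) * m (w c + w b / 2) = w b := by
        rcases (hb.trans hbm).eq_or_lt with h0 | h0
        · exact ⟨0, by simp; linarith⟩
        · refine ⟨⟨w b / (2 * m (w c + w b / 2)), div_nonneg hb h0.le,
            (div_le_one h0).2 hbm⟩, ?_⟩
          simp only
          rw [mul_assoc, mul_left_comm, div_mul_cancel₀ _ h0.ne']
      refine ⟨(s, ⟨w c + w b / 2, by linarith, by linarith⟩), ?_⟩
      refine hext _ _ ?_ ?_ ?_ (hΘn _) hwn
      · rw [hΘa]; simp only; linarith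
      · rw [hΘb]; exact hs
      · rw [hΘc]; simp only; linarith
  rw [hrange] at hG
  refine ⟨G, hG, ?_⟩
  have hedge : ∀ (u v : V) (t : ℝ), ∀ x ∉ ({u, v} : Finset V), edgePoint u v t x = 0 := by
    intro u v t x hx
    simp only [Finset.mem_insert, Finset.mem_singleton, not_or] at hx
    simp [edgePoint, hx.1, hx.2]
  have hGbc : ∀ u : I, G (edgePoint b c u) = q u := by
    intro u
    have hu0 := u.2.1
    have hu1 := u.2.2
    have hm : m ((1 + u) / 2) = (1 - u) / 2 := by
      simp only [m]; rw [min_eq_right (by linarith)]; ring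
    have e : edgePoint b c u = Θ (1, ⟨(1 + u) / 2, by linarith, by linarith⟩) := by
      refine hext _ _ ?_ ?_ ?_ (fun x hx => hedge _ _ _ x (by simp at hx ⊢; tauto)) (hΘn _)
      · rw [hΘa]; simp [hm, edgePoint, hab, hac]; ring
      · rw [hΘb]; simp [hm, edgePoint, hbc]; ring
      · rw [hΘc]; simp [hm, edgePoint, hbc.symm]; ring
    rw [e, hGH, H.apply_one]
    change (p.trans q) _ = _
    rcases hu0.eq_or_lt with h0 | h0
    · have : u = 0 := Subtype.ext h0.symm
      subst this
      simp [Path.trans_apply]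
    · rw [Path.trans_apply, dif_neg (by simp only; linarith)]
      congr 1
      ext
      simp only
      ring
  have hGab : ∀ u : I, G (edgePoint a b u) = p u := by
    intro u
    have hu0 := u.2.1
    have hu1 := u.2.2
    have hm : m (u / 2) = u / 2 := by
      simp only [m]; rw [min_eq_left (by linarith)]
    have e : edgePoint a b u = Θ (1, ⟨u / 2, by linarith, by linarith⟩) := by
      refine hext _ _ ?_ ?_ ?_ (fun x hx => hedge _ _ _ x (by simp at hx ⊢; tauto)) (hΘn _)
      · rw [hΘa]; simp [hm, edgePoint, hab]; ring
      · rw [hΘb]; simp [hm, edgePoint, hab.symm]; ring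
      · rw [hΘc]; simp [hm, edgePoint, hbc.symm, hac.symm]
    rw [e, hGH, H.apply_one]
    change (p.trans q) _ = _
    rw [Path.trans_apply, dif_pos (by simp only; linarith)]
    congr 1
    ext
    simp only
    ring
  have hGac : ∀ u : I, G (edgePoint a c u) = r u := by
    intro u
    have e : edgePoint a c u = Θ (0, u) := by
      refine hext _ _ ?_ ?_ ?_ (fun x hx => hedge _ _ _ x (by simp at hx ⊢; tauto)) (hΘn _)
      · rw [hΘa]; simp [edgePoint, hac]
      · rw [hΘb]; simp [edgePoint, hbc, hab.symm]
      · rw [hΘc]; simp [edgePoint, hac.symm]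
    rw [e, hGH, H.apply_zero]
    rfl
  rintro w ⟨⟨hw, hwn⟩, v, hv, hwv⟩
  have h1 := hw.2
  rw [hsum w hwn] at h1
  have ha := hw.1 a
  have hb := hw.1 b
  have hc := hw.1 c
  simp only [Finset.mem_insert, Finset.mem_singleton] at hv
  rcases hv with rfl | rfl | rfl
  · obtain ⟨u, rfl⟩ : ∃ u : I, w = edgePoint b c u := by
      refine ⟨⟨w c, hc, by linarith⟩,
        hext _ _ ?_ ?_ ?_ hwn fun x hx => hedge _ _ _ x (by simp at hx ⊢; tauto)⟩
      · simp [edgePoint, hab, hac, hwv]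
      · simp [edgePoint, hbc]; linarith
      · simp [edgePoint, hbc.symm]
    rw [hGbc, hq]
  · obtain ⟨u, rfl⟩ : ∃ u : I, w = edgePoint a c u := by
      refine ⟨⟨w c, hc, by linarith⟩,
        hext _ _ ?_ ?_ ?_ hwn fun x hx => hedge _ _ _ x (by simp at hx ⊢; tauto)⟩
      · simp [edgePoint, hac]; linarith
      · simp [edgePoint, hbc, hab.symm, hwv]
      · simp [edgePoint, hac.symm]
    rw [hGac, hr]
  · obtain ⟨u, rfl⟩ : ∃ u : I, w = edgePoint a b u := by
      refine ⟨⟨w b, hb, by linarith⟩,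
        hext _ _ ?_ ?_ ?_ hwn fun x hx => hedge _ _ _ x (by simp at hx ⊢; tauto)⟩
      · simp [edgePoint, hab]; linarith
      · simp [edgePoint, hab.symm]
      · simp [edgePoint, hbc.symm, hac.symm, hwv]
    rw [hGab, hp]

end Face

/-! ### Extension over a complex, face by face -/

section Extension

variable {V : Type*} [Fintype V]

/-- The union of the closed simplices spanned by the members of a set of faces. -/
def faceUnion (J : Set (Finset V)) : Set (V → ℝ) :=
  {w | ∃ s ∈ J, w ∈ closedFace s}

lemma faceUnion_eq_biUnion (J : Set (Finset V)) : faceUnion J = ⋃ s ∈ J, closedFace s := by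
  ext; simp [faceUnion]

lemma isClosed_faceUnion (J : Set (Finset V)) : IsClosed (faceUnion J) := by
  rw [faceUnion_eq_biUnion]
  exact J.toFinite.isClosed_biUnion fun s _ => (isCompact_closedFace s).isClosed

lemma faceUnion_mono {J J' : Set (Finset V)} (h : J ⊆ J') : faceUnion J ⊆ faceUnion J' :=
  fun _ ⟨s, hs, hw⟩ => ⟨s, h hs, hw⟩

lemma realization_eq_faceUnion (K : PreAbstractSimplicialComplex V) :
    realization K = faceUnion K.faces := by
  ext w
  exact ⟨fun ⟨h, s, hs, hw⟩ => ⟨s, hs, h, hw⟩, fun ⟨s, hs, h, hw⟩ => ⟨h, s, hs, hw⟩⟩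

variable [DecidableEq V]

lemma faceBoundary_subset_faceUnion {J : Set (Finset V)} {τ : Finset V}
    (hτ : ∀ ρ ⊂ τ, ρ.Nonempty → ρ ∈ J) : faceBoundary τ ⊆ faceUnion J := by
  rintro w ⟨⟨hw, hwn⟩, i, hi, hwi⟩
  have hn : ∀ j ∉ τ.erase i, w j = 0 := by
    intro j hj
    by_cases hji : j = i
    · rw [hji, hwi]
    · exact hwn j fun h => hj (Finset.mem_erase.2 ⟨hji, h⟩)
  refine ⟨τ.erase i, hτ _ (Finset.erase_ssubset hi) ?_, hw, hn⟩
  by_contra hne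
  rw [Finset.not_nonempty_iff_eq_empty] at hne
  have := hw.2
  rw [Finset.sum_eq_zero fun j _ => hn j (by simp [hne])] at this
  exact zero_ne_one this

/-- If a point of `τ` in a face `s` of `J` had no vanishing coordinate in `τ`, then `τ ⊆ s` would be
in `J`. So the two closed pieces meet only in the boundary of `τ`, where the maps agree. -/
lemma exists_glue_face {K : Type*} [TopologicalSpace K] {J : Set (Finset V)}
    (hJ : IsRelLowerSet J Finset.Nonempty) {τ : Finset V} (hne : τ.Nonempty) (hτJ : τ ∉ J)
    {F G : (V → ℝ) → K}
    (hF : ContinuousOn F (faceUnion J)) (hG : ContinuousOn G (closedFace τ))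
    (hGF : EqOn G F (faceBoundary τ)) :
    ∃ F' : (V → ℝ) → K, ContinuousOn F' (faceUnion (insert τ J)) ∧ EqOn F' F (faceUnion J) ∧
      EqOn F' G (closedFace τ) := by
  classical
  let F' : (V → ℝ) → K := fun w => if w ∈ closedFace τ then G w else F w
  have h1 : EqOn F' G (closedFace τ) := fun w hw => if_pos hw
  have h2 : EqOn F' F (faceUnion J) := by
    rintro w ⟨s, hs, hw⟩
    by_cases hwτ : w ∈ closedFace τ
    · rw [h1 hwτ]
      refine hGF ⟨hwτ, ?_⟩
      by_contra! h0
      refine hτJ ((hJ hs).2 (fun i hi => ?_) hne)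
      by_contra his
      exact h0 i hi (hw.2 i his)
    · exact if_neg hwτ
  refine ⟨F', ?_, h2, h1⟩
  have : faceUnion (insert τ J) = closedFace τ ∪ faceUnion J := by
    rw [faceUnion_eq_biUnion, biUnion_insert, faceUnion_eq_biUnion]
  rw [this]
  exact (hG.congr h1).union_of_isClosed (hF.congr h2) (isCompact_closedFace τ).isClosed
    (isClosed_faceUnion J)

lemma edgePoint_mem_closedFace (a b : V) (t : I) : edgePoint a b t ∈ closedFace {a, b} := by
  refine ⟨?_, fun i hi => ?_⟩
  · exact convex_stdSimplex ℝ V (single_mem_stdSimplex ℝ a) (single_mem_stdSimplex ℝ b)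
      (by linarith [t.2.2]) t.2.1 (by ring)
  · simp only [Finset.mem_insert, Finset.mem_singleton, not_or] at hi
    simp [edgePoint, hi.1, hi.2]

variable {X : Type*} [TopologicalSpace X] {K : Type*} [TopologicalSpace K] (Φ : C(X, K))
  (x : V → X) (O : V → Set X)

/-- On the edge from `u` to `v`, the map `F` is homotopic to the image under `Φ` of a path from
`x u` to `x v` in `O u ∪ O v`. -/
def IsGoodEdge (F : (V → ℝ) → K) (u v : V) : Prop :=
  ∃ (γ : Path (x u) (x v)) (δ : Path (Φ (x u)) (Φ (x v))), (∀ t, γ t ∈ O u ∪ O v) ∧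
    (∀ t : I, F (edgePoint u v t) = δ t) ∧ δ.Homotopic (γ.map Φ.continuous)

variable {Φ x O}

lemma IsGoodEdge.congr {F F' : (V → ℝ) → K} {u v : V} (h : IsGoodEdge Φ x O F u v)
    (hF : EqOn F' F (closedFace {u, v})) : IsGoodEdge Φ x O F' u v := by
  obtain ⟨γ, δ, h1, h2, h3⟩ := h
  exact ⟨γ, δ, h1, fun t => by rw [hF (edgePoint_mem_closedFace u v t), h2], h3⟩

-- The degenerate edge from `u` to `u` records the value at a vertex, so one notion covers vertices
-- and edges.
omit [Fintype V] in
lemma IsGoodEdge.apply_single {F : (V → ℝ) → K} {u : V} (h : IsGoodEdge Φ x O F u u) :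
    F (Pi.single u 1) = Φ (x u) := by
  obtain ⟨γ, δ, h1, h2, h3⟩ := h
  have := h2 0
  rwa [Icc.coe_zero, edgePoint, sub_zero, one_smul, zero_smul, add_zero, δ.source] at this

/-- The four cases are the four sources of a filling: a point `Φ (x a)`, the image of a joining
path, the equality of classes of paths in the union of three sets `O`, and the vanishing of `π_i(K)`
for `i ≥ 2`. -/
lemma exists_extension_face
    (hK : ∀ (i : ℕ) (k : K), 2 ≤ i → Subsingleton (HomotopyGroup (Fin i) K k))
    {J : Set (Finset V)} {τ : Finset V} (hne : τ.Nonempty)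
    (hτ : ∀ ρ ⊂ τ, ρ.Nonempty → ρ ∈ J) {F : (V → ℝ) → K} (hF : ContinuousOn F (faceUnion J))
    (hgood : ∀ u v, {u, v} ∈ J → IsGoodEdge Φ x O F u v)
    (hjoin : ∀ u v, {u, v} = τ → ∃ γ : Path (x u) (x v), ∀ t, γ t ∈ O u ∪ O v)
    (hnull : LoopsNullOn Φ (⋃ u ∈ τ, O u)) :
    ∃ G : (V → ℝ) → K, ContinuousOn G (closedFace τ) ∧ EqOn G F (faceBoundary τ) ∧
      ∀ u v, {u, v} = τ → IsGoodEdge Φ x O G u v := by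
  have hpos := Finset.card_pos.2 hne
  have hcases : τ.card = 1 ∨ τ.card = 2 ∨ τ.card = 3 ∨ 4 ≤ τ.card := by omega
  rcases hcases with h | h | h | h
  · obtain ⟨a, rfl⟩ := Finset.card_eq_one.1 h
    refine ⟨fun _ => Φ (x a), continuousOn_const, ?_, ?_⟩
    · rintro w ⟨⟨hw, hwn⟩, i, hi, hwi⟩
      rw [Finset.mem_singleton] at hi
      subst hi
      have := hw.2
      rw [sum_eq_of_forall_notMem hwn, Finset.sum_singleton, hwi] at this
      exact absurd this zero_ne_one
    · intro u v huv
      have hu : u = a := Finset.mem_singleton.1 (huv ▸ Finset.mem_insert_self u {v})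
      have hv : v = a := Finset.mem_singleton.1
        (huv ▸ Finset.mem_insert_of_mem (Finset.mem_singleton_self v))
      subst hu hv
      obtain ⟨γ, hγ⟩ := hjoin v v (by simp)
      refine ⟨Path.refl _, Path.refl _, fun t => ?_, fun t => rfl, ?_⟩
      · have := hγ 0
        simpa using this
      · exact Path.Homotopic.refl _
  · obtain ⟨a, b, hab, rfl⟩ := Finset.card_eq_two.1 h
    obtain ⟨γ, hγ⟩ := hjoin a b rfl
    have ha : IsGoodEdge Φ x O F a a := hgood a a (hτ _ (by
      rw [Finset.pair_eq_singleton]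
      exact Finset.ssubset_iff_subset_ne.2 ⟨by simp, fun h => by
        have := congrArg Finset.card h
        simp [hab] at this⟩) (by simp))
    have hb : IsGoodEdge Φ x O F b b := hgood b b (hτ _ (by
      rw [Finset.pair_eq_singleton]
      exact Finset.ssubset_iff_subset_ne.2 ⟨by simp, fun h => by
        have := congrArg Finset.card h
        simp [hab] at this⟩) (by simp))
    have hval : ∀ t : I, Φ (γ.extend (edgePoint a b t b)) = Φ (γ t) := by
      intro t
      have : edgePoint a b t b = t := by simp [edgePoint, hab.symm]
      rw [this, γ.extend_apply t.2]
    refine ⟨fun w => Φ (γ.extend (w b)), ?_, ?_, ?_⟩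
    · exact (Φ.continuous.comp (γ.continuous_extend.comp (continuous_apply b))).continuousOn
    · rintro w ⟨⟨hw, hwn⟩, i, hi, hwi⟩
      have h1 := hw.2
      rw [sum_eq_of_forall_notMem hwn, Finset.sum_pair hab] at h1
      simp only [Finset.mem_insert, Finset.mem_singleton] at hi
      have hext : ∀ w' : V → ℝ, w' a = w a → w' b = w b → (∀ j, j ≠ a → j ≠ b → w' j = 0) →
          w = w' := by
        intro w' h1 h2 h3
        ext j
        by_cases hja : j = a
        · rw [hja, h1]
        by_cases hjb : j = b
        · rw [hjb, h2]
        rw [h3 j hja hjb, hwn j (by simp [hja, hjb])]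
      rcases hi with rfl | rfl
      · have hwb : w b = 1 := by linarith
        have : w = Pi.single b 1 := hext _ (by simp [hab, hwi]) (by simp [hwb])
          (fun j _ hj => by simp [hj])
        simp only [hwb, Path.extend_one]
        rw [this, hb.apply_single]
      · have hwa : w a = 1 := by linarith
        have : w = Pi.single a 1 := hext _ (by simp [hwa]) (by simp [hab.symm, hwi])
          (fun j hj _ => by simp [hj])
        simp only [hwi, Path.extend_zero]
        rw [this, ha.apply_single]
    · intro u v huv
      have huv' : (u = a ∧ v = b) ∨ (u = b ∧ v = a) := by
        have hu : u ∈ ({a, b} : Finset V) := huv ▸ Finset.mem_insert_self u {v}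
        have hv : v ∈ ({a, b} : Finset V) :=
          huv ▸ Finset.mem_insert_of_mem (Finset.mem_singleton_self v)
        have huv'' : u ≠ v := by
          rintro rfl
          have := congrArg Finset.card huv
          simp [hab] at this
        simp only [Finset.mem_insert, Finset.mem_singleton] at hu hv
        rcases hu with rfl | rfl <;> rcases hv with rfl | rfl <;> simp_all
      rcases huv' with ⟨rfl, rfl⟩ | ⟨rfl, rfl⟩
      · exact ⟨γ, γ.map Φ.continuous, hγ, hval, Path.Homotopic.refl _⟩
      · refine ⟨γ.symm, (γ.map Φ.continuous).symm, fun t => (hγ _).symm, fun t => ?_,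
          Path.Homotopic.refl _⟩
        have := hval (σ t)
        have e : edgePoint v u (σ t) = edgePoint u v t := by
          simp only [edgePoint, coe_symm_eq, sub_sub_cancel]
          rw [add_comm]
        rw [e] at this
        exact this
  · obtain ⟨a, b, c, hab, hac, hbc, rfl⟩ := Finset.card_eq_three.1 h
    have hpair : ∀ u v, u ∈ ({a, b, c} : Finset V) → v ∈ ({a, b, c} : Finset V) →
        IsGoodEdge Φ x O F u v := by
      intro u v hu hv
      refine hgood u v (hτ _ (Finset.ssubset_iff_subset_ne.2 ⟨?_, fun h' => ?_⟩) (by simp))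
      · intro j hj
        rw [Finset.mem_insert, Finset.mem_singleton] at hj
        rcases hj with rfl | rfl <;> assumption
      · have := Finset.card_le_two (a := u) (b := v)
        rw [h'] at this
        omega
    obtain ⟨γ₁, δ₁, hγ₁, hF₁, hδ₁⟩ := hpair a b (by simp) (by simp)
    obtain ⟨γ₂, δ₂, hγ₂, hF₂, hδ₂⟩ := hpair b c (by simp) (by simp)
    obtain ⟨γ₃, δ₃, hγ₃, hF₃, hδ₃⟩ := hpair a c (by simp) (by simp)
    have hsub : ∀ u v, u ∈ ({a, b, c} : Finset V) → v ∈ ({a, b, c} : Finset V) →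
        O u ∪ O v ⊆ ⋃ u ∈ ({a, b, c} : Finset V), O u := fun u v hu hv =>
      union_subset (subset_biUnion_of_mem (u := O) hu) (subset_biUnion_of_mem (u := O) hv)
    have hcl := hnull.pathClass_eq (γ := γ₃) (γ' := γ₁.trans γ₂)
      (fun t => hsub a c (by simp) (by simp) (hγ₃ t))
      (Path.trans_mem (fun t => hsub a b (by simp) (by simp) (hγ₁ t))
        (fun t => hsub b c (by simp) (by simp) (hγ₂ t)))
    rw [pathClass_eq_iff, Path.map_trans] at hcl
    obtain ⟨G, hG, hGF⟩ := exists_extension_triangle hab hbc hac hF₁ hF₂ hF₃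
      ((hδ₃.trans hcl).trans (hδ₁.hcomp hδ₂).symm)
    refine ⟨G, hG, hGF, fun u v huv => ?_⟩
    have := Finset.card_le_two (a := u) (b := v)
    rw [huv] at this
    omega
  -- The boundary of a simplex with `τ.card` vertices is a sphere of dimension `τ.card - 2`, here at
  -- least two.
  · obtain ⟨G, hG, hGF⟩ := exists_extension_closedFace (K := K) (i := τ.card - 2) (by omega)
      (fun k => hK _ k (by omega)) (by omega)
      (hF.mono (faceBoundary_subset_faceUnion hτ))
    refine ⟨G, hG, hGF, fun u v huv => ?_⟩
    have := Finset.card_le_two (a := u) (b := v)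
    rw [huv] at this
    omega

/-- Extension of a map to a space with trivial higher homotopy groups from a subcomplex to a
complex. The map on the edges is prescribed by paths in `X`. -/
theorem exists_extension_faceUnion
    (hK : ∀ (i : ℕ) (k : K), 2 ≤ i → Subsingleton (HomotopyGroup (Fin i) K k))
    {M : Set (Finset V)} (hM : IsRelLowerSet M Finset.Nonempty)
    (hjoin : ∀ u v, {u, v} ∈ M → ∃ γ : Path (x u) (x v), ∀ t, γ t ∈ O u ∪ O v)
    (hnull : ∀ τ ∈ M, LoopsNullOn Φ (⋃ u ∈ τ, O u))
    {J : Set (Finset V)} (hJ : IsRelLowerSet J Finset.Nonempty) (hJM : J ⊆ M)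
    {F : (V → ℝ) → K} (hF : ContinuousOn F (faceUnion J))
    (hgood : ∀ u v, {u, v} ∈ J → IsGoodEdge Φ x O F u v) :
    ∃ F' : (V → ℝ) → K, ContinuousOn F' (faceUnion M) ∧ EqOn F' F (faceUnion J) := by
  induction hN : (M \ J).ncard generalizing J F with
  | zero =>
    rw [ncard_eq_zero, sdiff_eq_empty] at hN
    obtain rfl := hJM.antisymm hN
    exact ⟨F, hF, fun _ _ => rfl⟩
  | succ N ih =>
    have hnon : (M \ J).Nonempty := by
      rw [← ncard_pos]; omega
    -- A missing face of least cardinality has all its proper nonempty faces in `J`.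
    obtain ⟨τ, ⟨hτM, hτJ⟩, hmin⟩ := exists_min_image (M \ J) Finset.card (toFinite _) hnon
    have hsub : ∀ ρ ⊂ τ, ρ.Nonempty → ρ ∈ J := by
      intro ρ hρ hne
      by_contra hρJ
      have := hmin ρ ⟨(hM hτM).2 hρ.subset hne, hρJ⟩
      exact absurd (Finset.card_lt_card hρ) (not_lt.2 this)
    have hne := (hM hτM).1
    obtain ⟨G, hG, hGF, hGgood⟩ := exists_extension_face hK hne hsub hF hgood
      (fun u v huv => hjoin u v (huv ▸ hτM)) (hnull τ hτM)
    obtain ⟨F₁, hF₁, hF₁F, hF₁G⟩ := exists_glue_face hJ hne hτJ hF hG hGF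
    have hJ' : IsRelLowerSet (insert τ J) Finset.Nonempty := by
      rintro s (rfl | hs)
      · refine ⟨hne, fun ρ hρ hρne => ?_⟩
        rcases eq_or_ne ρ s with rfl | hρs
        · exact mem_insert _ _
        · exact mem_insert_of_mem _ (hsub ρ (lt_of_le_of_ne hρ hρs) hρne)
      · exact ⟨(hJ hs).1, fun ρ hρ hρne => mem_insert_of_mem _ ((hJ hs).2 hρ hρne)⟩
    have hgood' : ∀ u v, {u, v} ∈ insert τ J → IsGoodEdge Φ x O F₁ u v := by
      rintro u v (huv | huv)
      · exact (hGgood u v huv).congr (huv ▸ hF₁G)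
      · exact (hgood u v huv).congr fun w hw => hF₁F ⟨{u, v}, huv, hw⟩
    have hN' : (M \ insert τ J).ncard = N := by
      have : M \ insert τ J = (M \ J) \ {τ} := by
        ext s; simp only [Set.mem_sdiff, mem_insert_iff, mem_singleton_iff]; tauto
      rw [this, ncard_sdiff_singleton_of_mem (s := M \ J) ⟨hτM, hτJ⟩]
      omega
    obtain ⟨F', hF', hF'F⟩ := ih hJ' (insert_subset hτM hJM) hF₁ hgood' hN'
    exact ⟨F', hF', fun w hw =>
      (hF'F (faceUnion_mono (subset_insert τ J) hw)).trans (hF₁F hw)⟩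

end Extension

/-! ### Local triviality of loops in a simplicial complex -/

section LocalNull

lemma Path.homotopic_refl_congr {K : Type*} [TopologicalSpace K] {a a' : K} {p : Path a a}
    {p' : Path a' a'} (h : ∀ t, p t = p' t) (hp : p.Homotopic (Path.refl a)) :
    p'.Homotopic (Path.refl a') := by
  obtain rfl : a = a' := by simpa using h 0
  obtain rfl : p = p' := Path.ext (funext h)
  exact hp

lemma loopsNullOn_of_homeomorph {X Y K : Type*} [TopologicalSpace X] [TopologicalSpace Y]
    [TopologicalSpace K] (h : X ≃ₜ Y) {Φ : C(X, K)} {Ψ : C(Y, K)} (hΦ : ∀ x, Φ x = Ψ (h x))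
    {B : Set X} {B' : Set Y} (hB : ∀ x ∈ B, h x ∈ B') (hnull : LoopsNullOn Ψ B') :
    LoopsNullOn Φ B := by
  intro x γ hγ
  have := hnull _ (γ.map h.continuous) fun t => hB _ (hγ t)
  rw [← pathClass_refl, pathClass_eq_iff] at this ⊢
  exact Path.homotopic_refl_congr (fun t => (hΦ _).symm) this

/-- Loops in the open star of a point of a simplicial complex are null-homotopic. -/
lemma exists_loopsNullOn_nhds {m : ℕ} (K₀ : PreAbstractSimplicialComplex (Fin m)) {K : Type*}
    [TopologicalSpace K] (Φ : C(realization K₀, K)) (w : realization K₀) :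
    ∃ U ∈ 𝓝 w, LoopsNullOn Φ U := by
  let U' : Set (Fin m → ℝ) := {v | v ∈ realization K₀ ∧ ∀ i, w.1 i ≠ 0 → v i ≠ 0}
  have hopen : IsOpen {v : realization K₀ | ∀ i, w.1 i ≠ 0 → v.1 i ≠ 0} := by
    simp only [ofPred_forall]
    exact isOpen_iInter_of_finite fun i => isOpen_iInter_of_finite fun _ =>
      isOpen_ne_fun ((continuous_apply i).comp continuous_subtype_val) continuous_const
  refine ⟨_, hopen.mem_nhds fun i hi => hi, ?_⟩
  have hw : w.1 ∈ U' := ⟨w.2, fun i hi => hi⟩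
  -- A face that carries a point `v` of the open star also carries `w`, so the segment from `w` to
  -- `v` stays in the complex.
  have hstar : StarConvex ℝ w.1 U' := by
    rintro v ⟨hv, hvw⟩ a b ha hb hab
    obtain ⟨s, hs, hvs⟩ := hv.2
    have hws : ∀ i ∉ s, w.1 i = 0 := fun i hi => by
      by_contra h
      exact hvw i h (hvs i hi)
    refine ⟨⟨convex_stdSimplex ℝ _ w.2.1 hv.1 ha hb hab, s, hs, fun i hi => ?_⟩, fun i hi => ?_⟩
    · simp [hvs i hi, hws i hi]
    · have h1 : 0 < w.1 i := lt_of_le_of_ne (w.2.1.1 i) hi.symm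
      have h2 : 0 < v i := lt_of_le_of_ne (hv.1.1 i) (hvw i hi).symm
      simp only [Pi.add_apply, Pi.smul_apply, smul_eq_mul]
      rcases ha.eq_or_lt with h | h
      · have : b = 1 := by linarith
        rw [← h, this]
        linarith
      · have := mul_pos h h1
        have := mul_nonneg hb h2.le
        linarith
  have := hstar.contractibleSpace ⟨_, hw⟩
  intro x γ hγ
  have hmem : ∀ t, (γ t).1 ∈ U' := fun t => ⟨(γ t).2, hγ t⟩
  let ι : C(U', realization K₀) := ⟨fun v => ⟨v.1, v.2.1⟩, by fun_prop⟩
  let x' : U' := ⟨x.1, by simpa using hmem 0⟩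
  let δ : Path x' x' :=
    ⟨⟨fun t => ⟨(γ t).1, hmem t⟩, by fun_prop⟩, by simp [x'], by simp [x']⟩
  have h : (δ.map ι.continuous).Homotopic (Path.refl _) :=
    (SimplyConnectedSpace.paths_homotopic δ (Path.refl x')).map ι
  rw [← pathClass_refl]
  exact pathClass_congr (Path.homotopic_refl_congr (fun t => rfl) h)

end LocalNull

/-! ### Simplicial maps in barycentric coordinates -/

section PushForward

variable {V : Type*} [Fintype V]

lemma closedFace_mono {κ τ : Finset V} (h : κ ⊆ τ) : closedFace κ ⊆ closedFace τ :=
  fun _ hw => ⟨hw.1, fun i hi => hw.2 i fun h' => hi (h h')⟩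

variable [DecidableEq V]

/-- The linear extension of a map of vertices, in barycentric coordinates. -/
def pushVertices (f : V → V) (t : V → ℝ) (v : V) : ℝ :=
  ∑ z, if f z = v then t z else 0

lemma continuous_pushVertices (f : V → V) : Continuous (pushVertices f) := by
  refine continuous_pi fun v => continuous_finsetSum _ fun z _ => ?_
  split_ifs <;> fun_prop

lemma pushVertices_mem_closedFace (f : V → V) {t : V → ℝ} {κ : Finset V} (ht : t ∈ closedFace κ) :
    pushVertices f t ∈ closedFace (κ.image f) := by
  refine ⟨⟨fun v => Finset.sum_nonneg fun z _ => ?_, ?_⟩, fun v hv => ?_⟩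
  · split_ifs
    exacts [ht.1.1 z, le_rfl]
  · simp only [pushVertices]
    rw [Finset.sum_comm]
    simp [ht.1.2]
  · refine Finset.sum_eq_zero fun z _ => ?_
    split_ifs with h
    · exact ht.2 z fun hz => hv (h ▸ Finset.mem_image_of_mem f hz)
    · rfl

end PushForward

/-! ### The discrete Stein factorization -/

/-- If the fibres of a map from a finite complex to a finite complex with at most `n` vertices in
each face have neighbourhoods in which loops have null-homotopic images under `Φ`, and the target of
`Φ` has trivial higher homotopy groups, then `Φ` factors up to homotopy through a finite complex
with at most `n` vertices in each face. -/
theorem factorsThroughLowerComplex_of_fibers {m m' n : ℕ} (K₀ : PreAbstractSimplicialComplex (Fin m))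
    [Nonempty (realization K₀)] (P : PreAbstractSimplicialComplex (Fin m'))
    (hP : ∀ s ∈ P.faces, s.card ≤ n) (π : C(realization K₀, realization P))
    {K : Type*} [TopologicalSpace K] (Φ : C(realization K₀, K))
    (hK : ∀ (i : ℕ) (k : K), 2 ≤ i → Subsingleton (HomotopyGroup (Fin i) K k))
    (hfib : ∀ p, ∃ B : Set (realization K₀), IsOpen B ∧ π ⁻¹' {p} ⊆ B ∧ LoopsNullOn Φ B) :
    FactorsThroughLowerComplex n Φ := by
  classical
  have hcpt : ∀ {k : ℕ} (Q : PreAbstractSimplicialComplex (Fin k)),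
      CompactSpace (realization Q) := fun Q => by
    rw [← isCompact_iff_compactSpace]
    refine (isCompact_stdSimplex ℝ _).of_isClosed_subset ?_ fun w hw => hw.1
    rw [realization_eq_faceUnion]
    exact isClosed_faceUnion _
  have := hcpt K₀
  have := hcpt P
  -- small sets of `P` have preimages with null-homotopic loops
  obtain ⟨ε₁, hε₁, hnull₁⟩ : ∃ ε > 0, ∀ p, LoopsNullOn Φ (π ⁻¹' Metric.ball p ε) := by
    choose B hBo hB hBn using hfib
    -- The points whose whole fiber lies in `B p` form an open set, because `π` is a closed map.
    obtain ⟨ε, hε, h⟩ := lebesgue_number_lemma_of_metric (s := (univ : Set (realization P)))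
      (c := fun p => (π '' (B p)ᶜ)ᶜ) isCompact_univ
      (fun p => (π.continuous.isClosedMap _ (hBo p).isClosed_compl).isOpen_compl)
      (fun p _ => mem_iUnion.2 ⟨p, by
        rintro ⟨x, hx, hxp⟩
        exact hx (hB p hxp)⟩)
    refine ⟨ε, hε, fun p => ?_⟩
    obtain ⟨q, hq⟩ := h p (mem_univ p)
    refine (hBn q).mono fun x hx => ?_
    by_contra hxB
    exact hq hx ⟨x, hxB, rfl⟩
  obtain ⟨M₁, h₁, y, hh₁, -, -, hcov₁, hdist₁, hmult₁⟩ := exists_fine_cover P (half_pos hε₁)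
  let U : Fin M₁ → Set (realization P) := fun j => {p | 0 < h₁ j p}
  have hUo : ∀ j, IsOpen (U j) := fun j =>
    isOpen_lt continuous_const ((hh₁ j).comp continuous_subtype_val)
  have hUball : ∀ j, ∀ p ∈ U j, U j ⊆ Metric.ball p ε₁ := by
    intro j p hp q hq
    have h1 := (hdist₁ p p.2 j hp).1
    have h2 := (hdist₁ q q.2 j hq).1
    have := dist_triangle_right q.1 p.1 (y j)
    rw [Metric.mem_ball, Subtype.dist_eq]
    linarith
  obtain ⟨ε₂, hε₂, hleb⟩ := lebesgue_number_lemma_of_metric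
    (s := (univ : Set (realization K₀))) (c := fun j => π ⁻¹' U j) isCompact_univ
    (fun j => (hUo j).preimage π.continuous)
    (fun x _ => mem_iUnion.2 (hcov₁ _ (π x).2))
  obtain ⟨M₂, h, x, hh, hh0, hx, hcov, hdist, -⟩ := exists_fine_cover K₀ (half_pos hε₂)
  let px : Fin M₂ → realization K₀ := fun z => ⟨x z, hx z⟩
  -- Each vertex `z` of the finer cover is assigned a set `U (a z)` whose preimage contains the
  -- `ε₂`-ball about its central point.
  choose a ha using fun z => hleb (px z) (mem_univ _)
  let O : Fin M₂ → Set (realization K₀) := fun z => π ⁻¹' U (a z)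
  have hO : ∀ z z', a z = a z' → O z = O z' := fun z z' h => by simp only [O, h]
  -- the nerve of the cover of `K₀`
  let L : Set (Finset (Fin M₂)) :=
    {κ | κ.Nonempty ∧ ∃ w : realization K₀, ∀ z ∈ κ, 0 < h z w}
  have hL : IsRelLowerSet L Finset.Nonempty := fun κ hκ =>
    ⟨hκ.1, fun ρ hρ hne => ⟨hne, hκ.2.imp fun w hw z hz => hw z (hρ hz)⟩⟩
  have hwO : ∀ (w : realization K₀) z, 0 < h z w → w ∈ O z := by
    intro w z hz
    refine ha z ?_
    have := (hdist w w.2 z hz).1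
    rw [Metric.mem_ball, Subtype.dist_eq]
    change dist w.1 (x z) < ε₂
    linarith
  let C : (Fin M₂ → ℝ) → (Fin m → ℝ) := fun t => ∑ z, t z • x z
  have hC : Continuous C := by fun_prop
  -- `C` spans the nerve linearly by the central points. Those of members containing `w` lie in
  -- every face that carries `w`, so their simplex does too.
  have hCmem : ∀ (w : realization K₀) (s : Finset (Fin m)), (∀ i ∉ s, w.1 i = 0) →
      ∀ κ : Finset (Fin M₂), (∀ z ∈ κ, 0 < h z w) → ∀ t ∈ closedFace κ,
        C t ∈ stdSimplex ℝ (Fin m) ∧ ∀ i ∉ s, C t i = 0 := by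
    intro w s hws κ hκ t ht
    refine ⟨(convex_stdSimplex ℝ _).sum_mem (fun z _ => ht.1.1 z) ht.1.2 fun z _ => (hx z).1,
      fun i hi => ?_⟩
    simp only [C, Finset.sum_apply, Pi.smul_apply, smul_eq_mul]
    refine Finset.sum_eq_zero fun z _ => ?_
    by_cases hz : z ∈ κ
    · rw [(hdist w w.2 z (hκ z hz)).2 i (hws i hi), mul_zero]
    · rw [ht.2 z hz, zero_mul]
  have hCL : MapsTo C (faceUnion L) (realization K₀) := by
    rintro t ⟨κ, ⟨-, w, hw⟩, ht⟩
    obtain ⟨s, hs, hws⟩ := w.2.2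
    obtain ⟨h1, h2⟩ := hCmem w s hws κ hw t ht
    exact ⟨h1, s, hs, h2⟩
  have hCedge : ∀ u v t, C (edgePoint u v t) = (1 - t) • x u + t • x v := by
    intro u v t
    simp only [C, edgePoint, Pi.add_apply, Pi.smul_apply, add_smul, Finset.sum_add_distrib,
      smul_assoc, ← Finset.smul_sum]
    simp [Pi.single_apply, ite_smul]
  have hseg : ∀ u v, {u, v} ∈ L → ∃ γ : Path (px u) (px v),
      (∀ t : I, (γ t).1 = C (edgePoint u v t)) ∧ ∀ t, γ t ∈ O u := by
    intro u v huv
    have hmem : ∀ t : I, C (edgePoint u v t) ∈ realization K₀ := fun t =>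
      hCL ⟨_, huv, edgePoint_mem_closedFace u v t⟩
    have hcont : Continuous fun t : I => C (edgePoint u v t) := by
      simp only [hCedge]
      fun_prop
    refine ⟨⟨⟨fun t => ⟨C (edgePoint u v t), hmem t⟩, hcont.subtype_mk hmem⟩, ?_, ?_⟩, fun t => rfl,
      fun t => ha u ?_⟩
    · exact Subtype.ext (by simp [hCedge, px])
    · exact Subtype.ext (by simp [hCedge, px])
    · obtain ⟨-, w, hw⟩ := huv
      have h1 := (hdist w w.2 u (hw u (by simp))).1
      have h2 := (hdist w w.2 v (hw v (by simp))).1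
      have h3 := dist_triangle_left (x v) (x u) w.1
      have h4 : x v ∈ Metric.ball (x u) ε₂ := by rw [Metric.mem_ball]; linarith
      have h5 := convex_ball (x u) ε₂ (Metric.mem_ball_self hε₂) h4
        (by linarith [t.2.2] : (0 : ℝ) ≤ 1 - t) t.2.1 (by ring)
      rw [Metric.mem_ball, Subtype.dist_eq]
      change dist (C (edgePoint u v t)) (x u) < ε₂
      rw [hCedge]
      exact h5
  -- the quotient of the nerve which is the Stein factorization
  let r : Fin M₂ → Fin M₂ → Prop := fun z z' => {z, z'} ∈ L ∧ a z = a z'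
  -- Equivalent vertices are joined by a chain of segments, all inside the same pulled-back set.
  have hr : ∀ z z', Relation.EqvGen r z z' → a z = a z' ∧ JoinedIn (O z) (px z) (px z') := by
    intro z z' hzz'
    induction hzz' with
    | rel z z' h =>
      obtain ⟨γ, -, hγ⟩ := hseg z z' h.1
      exact ⟨h.2, γ, hγ⟩
    | refl z => exact ⟨rfl, JoinedIn.refl (ha z (Metric.mem_ball_self hε₂))⟩
    | symm z z' _ ih => exact ⟨ih.1.symm, by rw [← hO _ _ ih.1]; exact ih.2.symm⟩
    | trans z z' z'' _ _ ih ih' =>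
      exact ⟨ih.1.trans ih'.1, ih.2.trans (by rw [hO _ _ ih.1]; exact ih'.2)⟩
  obtain ⟨f, hf, hf'⟩ : ∃ f : Fin M₂ → Fin M₂, (∀ z, Relation.EqvGen r z (f z)) ∧
      ∀ z z', r z z' → f z = f z' := by
    let S := Relation.EqvGen.setoid r
    refine ⟨fun z => (Quotient.mk S z).out, fun z => ?_, fun z z' hzz' => ?_⟩
    · exact S.symm (Quotient.exact (Quotient.out_eq (Quotient.mk S z)))
    · have : Quotient.mk S z = Quotient.mk S z' := Quotient.sound (.rel _ _ hzz')
      simp only [this]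
  -- The faces of `κ ∪ κ.image f` provide room for the straight-line homotopy from a point of `κ` to
  -- its image under `f`.
  let M : Set (Finset (Fin M₂)) := {τ | τ.Nonempty ∧ ∃ κ ∈ L, τ ⊆ κ ∪ κ.image f}
  have hM : IsRelLowerSet M Finset.Nonempty := fun τ hτ =>
    ⟨hτ.1, fun ρ hρ hne => ⟨hne, hτ.2.imp fun κ hκ => ⟨hκ.1, hρ.trans hκ.2⟩⟩⟩
  let N : PreAbstractSimplicialComplex (Fin M₂) :=
    { faces := {τ | τ.Nonempty ∧ ∃ κ ∈ L, τ ⊆ κ.image f}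
      isRelLowerSet_faces := fun τ hτ =>
        ⟨hτ.1, fun ρ hρ hne => ⟨hne, hτ.2.imp fun κ hκ => ⟨hκ.1, hρ.trans hκ.2⟩⟩⟩ }
  have hLM : L ⊆ M := fun κ hκ => ⟨hκ.1, κ, hκ, Finset.subset_union_left⟩
  have hNM : N.faces ⊆ M := fun τ hτ => ⟨hτ.1, hτ.2.imp fun κ hκ =>
    ⟨hκ.1, hκ.2.trans Finset.subset_union_right⟩⟩
  have hN : ∀ τ ∈ N.faces, τ.card ≤ n := by
    rintro τ ⟨-, κ, ⟨hκne, w, hw⟩, hτ⟩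
    -- Any two vertices of `κ` are adjacent in the nerve, so if they have the same `a` they are
    -- related and `f` identifies them. The values of `a` on `κ` index members of the cover of `P`
    -- that contain `π w`.
    have h1 : (κ.image f).card ≤ (κ.image a).card := by
      refine Finset.card_le_card_of_injOn a ?_ ?_
      · intro v hv
        obtain ⟨z, hz, rfl⟩ := Finset.mem_image.1 hv
        rw [← (hr _ _ (hf z)).1]
        exact Finset.mem_image_of_mem a hz
      · intro v hv v' hv' hvv'
        obtain ⟨z, hz, rfl⟩ := Finset.mem_image.1 hv
        obtain ⟨z', hz', rfl⟩ := Finset.mem_image.1 hv'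
        rw [← (hr _ _ (hf z)).1, ← (hr _ _ (hf z')).1] at hvv'
        refine hf' _ _ ⟨⟨by simp, w, fun u hu => ?_⟩, hvv'⟩
        simp only [Finset.mem_insert, Finset.mem_singleton] at hu
        rcases hu with rfl | rfl
        exacts [hw _ hz, hw _ hz']
    refine (Finset.card_le_card hτ).trans (h1.trans ?_)
    refine le_trans (Finset.card_le_card fun j hj => ?_) (hmult₁ n hP (π w) (π w).2)
    obtain ⟨z, hz, rfl⟩ := Finset.mem_image.1 hj
    rw [Finset.mem_filter]
    exact ⟨Finset.mem_univ _, hwO w z (hw z hz)⟩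
  have hMκ : ∀ (κ : Finset (Fin M₂)), ∀ u ∈ κ ∪ κ.image f,
      ∃ z ∈ κ, O z = O u ∧ JoinedIn (O u) (px u) (px z) := by
    intro κ u hu
    rcases Finset.mem_union.1 hu with hu | hu
    · exact ⟨u, hu, rfl, JoinedIn.refl (ha u (Metric.mem_ball_self hε₂))⟩
    · obtain ⟨z, hz, rfl⟩ := Finset.mem_image.1 hu
      obtain ⟨h1, h2⟩ := hr _ _ (hf z)
      exact ⟨z, hz, hO _ _ h1, by rw [← hO _ _ h1]; exact h2.symm⟩
  have hjoin : ∀ u v, {u, v} ∈ M → ∃ γ : Path (px u) (px v), ∀ t, γ t ∈ O u ∪ O v := by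
    rintro u v ⟨-, κ, hκ, huv⟩
    obtain ⟨z, hz, hOz, hjz⟩ := hMκ κ u (huv (by simp))
    obtain ⟨z', hz', hOz', hjz'⟩ := hMκ κ v (huv (by simp))
    have hsub : ({z, z'} : Finset (Fin M₂)) ⊆ κ := by
      intro j hj
      simp only [Finset.mem_insert, Finset.mem_singleton] at hj
      rcases hj with rfl | rfl <;> assumption
    obtain ⟨γ, -, hγ⟩ := hseg z z' ((hL hκ).2 hsub (by simp))
    have hzz' : JoinedIn (O u) (px z) (px z') := ⟨γ, fun t => hOz ▸ hγ t⟩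
    exact ((hjz.trans hzz').mono subset_union_left).trans (hjz'.symm.mono subset_union_right)
  have hnull : ∀ τ ∈ M, LoopsNullOn Φ (⋃ u ∈ τ, O u) := by
    rintro τ ⟨-, κ, ⟨-, w, hw⟩, hτ⟩
    -- Every set `O u` involved is the preimage of a member containing `π w`, and such members lie
    -- in the `ε₁`-ball about `π w`.
    refine (hnull₁ (π w)).mono (iUnion₂_subset fun u hu => ?_)
    obtain ⟨z, hz, hOz, -⟩ := hMκ κ u (hτ hu)
    rw [← hOz]
    exact preimage_mono (hUball _ _ (hwO w z (hw z hz)))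
  have : Nonempty K := ⟨Φ (Classical.arbitrary _)⟩
  obtain ⟨Φ', hΦ'c, hΦ'⟩ : ∃ Φ' : (Fin m → ℝ) → K, ContinuousOn Φ' (realization K₀) ∧
      ∀ w : realization K₀, Φ' w = Φ w := by
    obtain ⟨Φ', h1, h2⟩ := exists_continuousOn_range (Θ := ((↑) : realization K₀ → Fin m → ℝ))
      continuous_subtype_val Φ.continuous (fun w w' h => congrArg Φ (Subtype.ext h))
    exact ⟨Φ', by rwa [Subtype.range_coe] at h1, h2⟩
  obtain ⟨F, hF, hFL⟩ := exists_extension_faceUnion (Φ := Φ) (x := px) (O := O) hK hM hjoin hnull hL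
    hLM (hΦ'c.comp hC.continuousOn hCL) (fun u v huv => by
      obtain ⟨γ, h1, h2⟩ := hseg u v huv
      exact ⟨γ, γ.map Φ.continuous, fun t => Or.inl (h2 t),
        fun t => by simp only [Function.comp, ← h1, hΦ']; rfl, Path.Homotopic.refl _⟩)
  -- the barycentric map to the nerve
  have hpos : ∀ w : realization K₀, 0 < ∑ z, h z w := fun w => by
    obtain ⟨z, hz⟩ := hcov w w.2
    exact Finset.sum_pos' (fun z _ => hh0 z w) ⟨z, Finset.mem_univ z, hz⟩
  let b : realization K₀ → Fin M₂ → ℝ := fun w z => h z w / ∑ z, h z w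
  have hb : Continuous b := by
    refine continuous_pi fun z => ?_
    have h1 : ∀ z, Continuous fun w : realization K₀ => h z w := fun z =>
      (hh z).comp continuous_subtype_val
    exact (h1 z).div (continuous_finsetSum _ fun z _ => h1 z) fun w => (hpos w).ne'
  let κ : realization K₀ → Finset (Fin M₂) := fun w => Finset.univ.filter fun z => 0 < h z w
  have hκh : ∀ w, ∀ z ∈ κ w, 0 < h z w := fun w z hz => (Finset.mem_filter.1 hz).2
  have hκ : ∀ w, κ w ∈ L := fun w => ⟨by
    obtain ⟨z, hz⟩ := hcov w w.2
    exact ⟨z, Finset.mem_filter.2 ⟨Finset.mem_univ z, hz⟩⟩, w, hκh w⟩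
  have hbκ : ∀ w, b w ∈ closedFace (κ w) := by
    refine fun w => ⟨⟨fun z => div_nonneg (hh0 z w) (hpos w).le, ?_⟩, fun z hz => ?_⟩
    · rw [← Finset.sum_div, div_self (hpos w).ne']
    · have : h z w = 0 := by
        by_contra h0
        exact hz (Finset.mem_filter.2 ⟨Finset.mem_univ z, lt_of_le_of_ne (hh0 z w) (Ne.symm h0)⟩)
      simp only [b, this, zero_div]
  have hfκ : ∀ w, pushVertices f (b w) ∈ closedFace ((κ w).image f) := fun w =>
    pushVertices_mem_closedFace f (hbκ w)
  have hfN : ∀ w, pushVertices f (b w) ∈ realization N := fun w => by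
    rw [realization_eq_faceUnion]
    exact ⟨_, ⟨(hκ w).1.image f, _, hκ w, subset_rfl⟩, hfκ w⟩
  let f₁ : C(realization K₀, realization N) :=
    ⟨fun w => ⟨pushVertices f (b w), hfN w⟩, by
      have := (continuous_pushVertices f).comp hb
      exact this.subtype_mk _⟩
  let g₁ : C(realization N, K) := ⟨fun t => F t, by
    refine hF.comp_continuous continuous_subtype_val fun t => faceUnion_mono hNM ?_
    rw [← realization_eq_faceUnion]
    exact t.2⟩
  refine ⟨M₂, N, hN, f₁, g₁, ?_⟩
  have hline : ∀ {E : Type} [AddCommGroup E] [Module ℝ E] {S : Set E}, Convex ℝ S →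
      ∀ {p q : E}, p ∈ S → q ∈ S → ∀ t : I, (1 - (t : ℝ)) • p + (t : ℝ) • q ∈ S :=
    fun hS p q hp hq t => hS hp hq (by linarith [t.2.2]) t.2.1 (by ring)
  let Φ₁ : C(realization K₀, K) := ⟨fun w => Φ' (C (b w)), hΦ'c.comp_continuous (hC.comp hb)
    fun w => hCL ⟨_, hκ w, hbκ w⟩⟩
  -- A face that carries `w` also carries `C (b w)`, so the segment between them stays in `K₀`.
  have H₁ : Φ.Homotopic Φ₁ := by
    refine ⟨⟨⟨fun p => Φ' ((1 - (p.1 : ℝ)) • p.2.1 + (p.1 : ℝ) • C (b p.2)), ?_⟩, ?_, ?_⟩⟩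
    · refine hΦ'c.comp_continuous (by fun_prop) ?_
      rintro ⟨t, w⟩
      obtain ⟨s, hs, hws⟩ := w.2.2
      obtain ⟨h1, h2⟩ := hCmem w s hws _ (hκh w) _ (hbκ w)
      refine ⟨hline (convex_stdSimplex ℝ _) w.2.1 h1 t, s, hs, fun i hi => ?_⟩
      simp [hws i hi, h2 i hi]
    · intro w; simp [hΦ']
    · intro w; simp [Φ₁]
  have H₂ : Φ₁.Homotopic (g₁.comp f₁) := by
    refine ⟨⟨⟨fun p => F ((1 - (p.1 : ℝ)) • b p.2 + (p.1 : ℝ) • pushVertices f (b p.2)), ?_⟩,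
      ?_, ?_⟩⟩
    · refine hF.comp_continuous (((continuous_const.sub
        (continuous_subtype_val.comp continuous_fst)).smul (hb.comp continuous_snd)).add
        ((continuous_subtype_val.comp continuous_fst).smul
          ((continuous_pushVertices f).comp (hb.comp continuous_snd)))) ?_
      rintro ⟨t, w⟩
      refine ⟨κ w ∪ (κ w).image f, ⟨(hκ w).1.mono Finset.subset_union_left, _, hκ w, subset_rfl⟩,
        hline (convex_closedFace _) (closedFace_mono Finset.subset_union_left (hbκ w))
          (closedFace_mono Finset.subset_union_right (hfκ w)) t⟩
    · intro w
      have : F (b w) = Φ' (C (b w)) := hFL ⟨_, hκ w, hbκ w⟩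
      simp [Φ₁, this]
    · intro w; simp [f₁, g₁]
  exact H₁.trans H₂

/-! ### The proposition -/

theorem proposition2p12 (n : ℕ) {X : Type u} [MetricSpace X] [ConnectedSpace X]
    (hX : IsPolyhedralLengthSpace n X) (x₀ : X) {G : Type v} [Group G]
    (φ : FundamentalGroup X x₀ →* G) (hφ : φ ≠ 1) (hess : IsEssential.{u, v, w} n φ) :
    ¬ Collapses n (fun x => systolicFunction φ x / 2) := by
  obtain ⟨K, _, Φ, ⟨hK, θ, hθ⟩, hΦ⟩ := hess
  obtain ⟨⟨m, K₀, -, -, ⟨h⟩⟩, hlen⟩ := hX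
  rintro ⟨m', P, hP, π, hπ⟩
  apply hΦ
  let Ψ : C(realization K₀, K) := Φ.comp h.symm
  have hΨ : ∀ x, Φ x = Ψ (h x) := fun x => by simp [Ψ]
  have hloc : ∀ x : X, ∃ U ∈ 𝓝 x, LoopsNullOn Φ U := by
    intro x
    obtain ⟨U, hU, hUn⟩ := exists_loopsNullOn_nhds K₀ Ψ (h x)
    exact ⟨h ⁻¹' U, h.continuous.continuousAt hU,
      loopsNullOn_of_homeomorph h hΨ (fun _ hx => hx) hUn⟩
  have hball : ∀ x : X, LoopsNullOn Φ (Metric.eball x (systolicFunction φ x / 2)) := by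
    refine fun x => loopsNullOn_eball hlen hloc fun γ hγ => ?_
    rw [ENNReal.add_halves] at hγ
    obtain ⟨c, -⟩ := hlen.exists_path_lt (x := x₀) (y := x) (r := ⊤) (edist_lt_top _ _)
    have hnon : ¬ IsNontrivialLoop φ γ := fun hγ' => hγ.not_ge (iInf₂_le γ hγ')
    have h1 : φ (FundamentalGroup.fromPath
        (Path.Homotopic.Quotient.mk ((c.trans γ).trans c.symm))) = 1 := by
      by_contra h1
      exact hnon ⟨c, h1⟩
    -- Since `θ` is injective, triviality under `φ` is triviality of the image under `Φ`;
    -- conjugation by `c` is then undone.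
    rw [← hθ, map_eq_one_iff θ θ.injective] at h1
    have h2 : pathClass Φ ((c.trans γ).trans c.symm) = 𝟙 _ := h1
    rw [pathClass_trans, pathClass_trans, pathClass_symm, IsIso.comp_inv_eq, Category.id_comp] at h2
    rwa [← cancel_epi (pathClass Φ c), Category.comp_id]
  have : Nonempty (realization K₀) := ⟨h x₀⟩
  have hfac : FactorsThroughLowerComplex n Ψ := by
    refine factorsThroughLowerComplex_of_fibers K₀ P hP (π.comp h.symm) Ψ hK.pi_higher fun p => ?_
    obtain ⟨x, hx⟩ := hπ p
    refine ⟨h.symm ⁻¹' Metric.eball x (systolicFunction φ x / 2),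
      Metric.isOpen_eball.preimage h.symm.continuous, fun y hy => hx hy, ?_⟩
    exact loopsNullOn_of_homeomorph h.symm (fun _ => rfl) (fun _ hy => hy) (hball x)
  obtain ⟨k, Q, hQ, f, g, hfg⟩ := hfac
  refine ⟨k, Q, hQ, f.comp h, g, ?_⟩
  have := hfg.comp (ContinuousMap.Homotopic.refl (h : C(X, realization K₀)))
  have e : Ψ.comp (h : C(X, realization K₀)) = Φ := ContinuousMap.ext fun x => (hΨ x).symm
  rw [e] at this
  exact this
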